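/- Let $f_\zeta$ be a probability density on $\mathbb R$; for integrable $g$ write $\hat g(\omega)=\int g(x)e^{i\omega x}\,dx$. Let $Y_j=X_j+\zeta_j$, $j=1,\dots,n$, where $X_1,\dots,X_n$ are i.i.d. with distribution function $F$, and $\zeta_1,\dots,\zeta_n$ are i.i.d. with density $f_\zeta$ and independent of the $X_j$. For $t_0\in\mathbb R$, an estimator of $F(t_0)$ is a measurable function $\tilde F=\tilde F(Y_1,\dots,Y_n)$. For a family $\mathcal F$ of distributions and $\epsilon\in(0,1/2)$ put $$\mathrm{Risk}_2[\tilde F;\mathcal F]=\sup_{F\in\mathcal F}\{E|\tilde F-F(t_0)|^2\}^{1/2},\qquad \mathrm{Risk}_\epsilon[\tilde F;\mathcal F]=\min\Bigl\{\delta\ge 0:\sup_{F\in\mathcal F}P[|\tilde F-F(t_0)|>\delta]\le\epsilon\Bigr\}.$$ For $L>0$ let $\mathcal F_\alpha(L)$ be the set of distributions on $\mathbb R$ that have a density $f$ with $\frac1{2\pi}\int_{-\infty}^\infty|\hat f(\omega)|^2(1+\omega^2)^\alpha\,d\omega\le L^2$. **Theorem.** Let $\alpha>1/2$ and $\beta>1/2$.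 Suppose that $\hat f_\zeta$ is twice differentiable and that there are $C_\zeta>0$ and $\omega_*>0$ with $$(1+\omega^2)^{\beta/2}\max_{j=0,1,2}|\hat f_\zeta^{(j)}(\omega)|\le C_\zeta\qquad\text{for all }|\omega|\ge\omega_*.$$ Then there are constants $c_1,c_2>0$, depending only on $\alpha$, $\beta$ and $f_\zeta$, such that for every $L>0$ with $L^2\ge\pi^{-1}2^{1+(\alpha-1)_+}\Gamma(2\alpha+1)$ there is $n_0$ (depending only on $\alpha,\beta,f_\zeta,L$) such that for every $t_0\in\mathbb R$: $$\inf_{\tilde F}\mathrm{Risk}_2[\tilde F;\mathcal F_\alpha(L)]\ge c_1L^{(2\beta-1)/(2\alpha+2\beta)}\,\phi(n)\qquad\text{for all } n\ge n_0,$$ $$\inf_{\tilde F}\mathrm{Risk}_\epsilon[\tilde F;\mathcal F_\alpha(L)]\ge c_2L^{(2\beta-1)/(2\alpha+2\beta)}\,\phi\bigl(n/\ln(1/\epsilon)\bigr)\qquad\text{for all }\epsilon\in(0,1/2)\text{ and all } n\ge n_0\ln(1/\epsilon),$$ where $\phi(z)=z^{-(2\alpha+1)/(4\alpha+4\beta)}$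 and the infima are over all estimators of $F(t_0)$. -/

import Mathlib

open MeasureTheory ProbabilityTheory
open scoped ENNReal NNReal

noncomputable section

namespace Deconv

/-- `f` is a probability density with respect to Lebesgue measure on the real line. -/
structure IsDensity (f : ℝ → ℝ) : Prop where
  measurable : Measurable f
  nonneg : ∀ x, 0 ≤ f x
  lintegral_eq_one : ∫⁻ x, ENNReal.ofReal (f x) = 1

/-- The distribution on the real line with density `f`. -/
def law (f : ℝ → ℝ) : Measure ℝ :=
  volume.withDensity fun x => ENNReal.ofReal (f x)

/-- The Fourier transform `ĝ(ω) = ∫ g(x) exp(iωx) dx`. -/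
def hat (g : ℝ → ℝ) (ω : ℝ) : ℂ :=
  ∫ x : ℝ, (g x : ℂ) * Complex.exp (Complex.I * (ω : ℂ) * (x : ℂ))

/-- The Sobolev class of distributions: those having a density `f` with
`(2π)⁻¹ ∫ |f̂(ω)|² (1 + ω²)^α dω ≤ L²`. The integral is a Lebesgue integral with values in
`[0, ∞]`, so that the bound includes its finiteness. -/
def sobolevClass (α L : ℝ) : Set (Measure ℝ) :=
  {μ | ∃ f : ℝ → ℝ, IsDensity f ∧ μ = law f ∧
    ENNReal.ofReal (1 / (2 * Real.pi)) *
      ∫⁻ ω : ℝ, ENNReal.ofReal (‖hat f ω‖ ^ 2 * (1 + ω ^ 2) ^ α) ≤ ENNReal.ofReal (L ^ 2)}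

/-- The tail condition with exponent `β` on the error density: its Fourier transform is twice
differentiable, and it and its first two derivatives are `O((1 + ω²)^(-β/2))` away from `0`. -/
structure ErrorTails (fζ : ℝ → ℝ) (β : ℝ) : Prop where
  half_lt : 1 / 2 < β
  differentiable : Differentiable ℝ (hat fζ)
  differentiable_deriv : Differentiable ℝ (deriv (hat fζ))
  bound : ∃ C > 0, ∃ ω₀ > 0, ∀ ω : ℝ, ω₀ ≤ |ω| → ∀ j : ℕ, j ≤ 2 →
    (1 + ω ^ 2) ^ (β / 2) * ‖iteratedDeriv j (hat fζ) ω‖ ≤ C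

/-- The joint distribution of `n` independent observations `Y_j = X_j + ζ_j`, where `X_j` has
distribution `μ` and `ζ_j` has density `fζ` and is independent of `X_j`. -/
def obsLaw (fζ : ℝ → ℝ) (n : ℕ) (μ : Measure ℝ) : Measure (Fin n → ℝ) :=
  Measure.pi fun _ => μ.conv (law fζ)

/-- The maximal quadratic risk `sup_F (E |T(Y₁, …, Yₙ) - F(t₀)|²)^{1/2}` over the family `𝓕`. -/
def quadRisk (fζ : ℝ → ℝ) (n : ℕ) (t₀ : ℝ) (𝓕 : Set (Measure ℝ)) (T : (Fin n → ℝ) → ℝ) : ℝ≥0∞ :=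
  ⨆ μ ∈ 𝓕, (∫⁻ y, ENNReal.ofReal (|T y - cdf μ t₀| ^ 2) ∂(obsLaw fζ n μ)) ^ (1 / 2 : ℝ)

/-- The maximal `ε`-risk `min {δ : sup_F P(|T(Y₁, …, Yₙ) - F(t₀)| > δ) ≤ ε}` over the family `𝓕`
(infinite if there is no such `δ`). -/
def epsRisk (fζ : ℝ → ℝ) (n : ℕ) (t₀ : ℝ) (𝓕 : Set (Measure ℝ)) (ε : ℝ)
    (T : (Fin n → ℝ) → ℝ) : ℝ≥0∞ :=
  ⨅ (δ : ℝ≥0)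
    (_ : (⨆ μ ∈ 𝓕, obsLaw fζ n μ {y | (δ : ℝ) < |T y - cdf μ t₀|}) ≤ ENNReal.ofReal ε), (δ : ℝ≥0∞)

/-- The minimax quadratic risk: the infimum over all estimators, i.e. all measurable functions of
the observations. -/
def minimaxQuadRisk (fζ : ℝ → ℝ) (n : ℕ) (t₀ : ℝ) (𝓕 : Set (Measure ℝ)) : ℝ≥0∞ :=
  ⨅ (T : (Fin n → ℝ) → ℝ) (_ : Measurable T), quadRisk fζ n t₀ 𝓕 T

/-- The minimax `ε`-risk. -/
def minimaxEpsRisk (fζ : ℝ → ℝ) (n : ℕ) (t₀ : ℝ) (𝓕 : Set (Measure ℝ)) (ε : ℝ) : ℝ≥0∞ :=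
  ⨅ (T : (Fin n → ℝ) → ℝ) (_ : Measurable T), epsRisk fζ n t₀ 𝓕 ε T

/-- The rate `φ(z) = z^{-(2α+1)/(4α+4β)}`. -/
def rate (α β z : ℝ) : ℝ := z ^ (-((2 * α + 1) / (4 * α + 4 * β)))

end Deconv

end

/-!
The lower bound compares three distributions of the class: the Cauchy density centred at `t₀`, and
this density plus and minus a small oscillating perturbation `h`. The perturbation is
`h x = a N k (N (x - t₀))`, where `k` is a real Schwartz function with Fourier transform supported
in `1 ≤ |ξ| ≤ 3` and `∫_{x ≤ 0} k > 0` (`exists_profile`). Then: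

* the three values of `F(t₀)` differ by multiples of `a ∫_{x ≤ 0} k`;
* the Cauchy density uses at most `3/8` of the squared Sobolev budget `L²`, because its Fourier
  transform is `exp (-|ω|)` (`lintegral_sobolev_cauchy_le`), and the perturbation fits into the rest
  when `a` is a small multiple of `L N^(-(α + 1/2))` (`lintegral_sobolev_wavelet_le`); as
  `α > 1/2`, the amplitude `a N` of `h` tends to `0`, and the densities are nonnegative for large
  `N`;
* after convolution with the error density the perturbation has chi-square distance of order
  `a² N^(1 - 2β)` from the centre. The density of an observation is at least `c / (1 + y²)`
  (`exists_le_smear_cauchy`), so this distance is controlled by the `L²` norm with weight `1 + y²`,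
  that is, on the Fourier side, by a function and its derivative
  (`lintegral_one_add_sq_mul_smear_wavelet_sq_le`). All frequencies involved are at least `N`, where
  the tail condition on the error density applies.

With `N` of order `(L² n / ln (1/ε))^(1 / (2α + 2β))` the `n`-fold chi-square distance is at most
`ln (1/ε) / 16`. If an estimator had error below half the separation with probability `1 - ε` under
all three distributions, there would be three disjoint events, each of probability at least `1 - ε`
under its own distribution; `not_three_disjoint_tests` excludes this for every `ε < 1/2`. Three
hypotheses are needed because the constant has to be uniform as `ε → 1/2`. The quadratic risk
follows from the case `ε = 1/4` by Chebyshev's inequality (`epsRisk_le_two_mul_quadRisk`).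
-/

namespace Deconv

open scoped FourierTransform
open Filter Topology

/-! ### Indistinguishability of three product measures -/

theorem pi_withDensity_ofReal {Ω : Type*} [MeasurableSpace Ω] {μ : Measure Ω}
    [IsProbabilityMeasure μ] {r : Ω → ℝ} (hr : ∀ x, 0 ≤ r x) (hi : Integrable r μ) (n : ℕ) :
    Measure.pi (fun _ : Fin n => μ.withDensity fun x => ENNReal.ofReal (r x)) =
      (Measure.pi fun _ : Fin n => μ).withDensity fun y => ENNReal.ofReal (∏ i, r (y i)) := by
  have : IsFiniteMeasure (μ.withDensity fun x => ENNReal.ofReal (r x)) :=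
    isFiniteMeasure_withDensity_ofReal hi.2
  refine Measure.pi_eq fun s hs => ?_
  have hI : Integrable (fun y : Fin n → Ω => ∏ i, (s i).indicator r (y i))
      (Measure.pi fun _ : Fin n => μ) :=
    Integrable.fintype_prod_dep (μ := fun _ : Fin n => μ) fun i => hi.indicator (hs i)
  have hsm : MeasurableSet (Set.univ.pi s) := MeasurableSet.univ_pi hs
  rw [withDensity_apply _ hsm, ← lintegral_indicator hsm]
  have h1 : ∀ y : Fin n → Ω, (Set.univ.pi s).indicator
      (fun y => ENNReal.ofReal (∏ i, r (y i))) y =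
        ENNReal.ofReal (∏ i, (s i).indicator r (y i)) := by
    intro y
    by_cases hy : y ∈ Set.univ.pi s
    · rw [Set.indicator_of_mem hy]
      congr 1
      refine Finset.prod_congr rfl fun i _ => ?_
      rw [Set.indicator_of_mem (hy i (Set.mem_univ i))]
    · rw [Set.indicator_of_notMem hy]
      simp only [Set.mem_univ_pi, not_forall] at hy
      obtain ⟨i, hi'⟩ := hy
      rw [Finset.prod_eq_zero (Finset.mem_univ i) (Set.indicator_of_notMem hi' _)]
      simp
  have h0 : ∀ i x, 0 ≤ (s i).indicator r x := fun i x => Set.indicator_nonneg (fun x _ => hr x) x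
  simp_rw [h1]
  rw [← ofReal_integral_eq_lintegral_ofReal hI
    (Filter.Eventually.of_forall fun y => Finset.prod_nonneg fun i _ => h0 i _),
    integral_fintype_prod_eq_prod (μ := fun _ : Fin n => μ) (fun i => (s i).indicator r),
    ENNReal.ofReal_prod_of_nonneg fun i _ => integral_nonneg (h0 i)]
  refine Finset.prod_congr rfl fun i _ => ?_
  rw [withDensity_apply _ (hs i), ofReal_integral_eq_lintegral_ofReal (hi.indicator (hs i))
    (Filter.Eventually.of_forall (h0 i)), ← lintegral_indicator (hs i)]
  congr with x
  by_cases hx : x ∈ s i <;> simp [hx]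

/-- A likelihood ratio `r` with second moment close to `1` cannot raise the probability of an
event by much. The parameter `t` comes from `r - 1 ≤ t / 2 + (r - 1)² / (2t)`. -/
theorem withDensity_real_le {Ω : Type*} [MeasurableSpace Ω] {P : Measure Ω}
    [IsProbabilityMeasure P] {r : Ω → ℝ} (hr : ∀ x, 0 ≤ r x) (hi : Integrable r P)
    (hi2 : Integrable (fun x => r x ^ 2) P) (h1 : ∫ x, r x ∂P = 1) {A : Set Ω}
    (hA : MeasurableSet A) {t : ℝ} (ht : 0 < t) :
    (P.withDensity fun x => ENNReal.ofReal (r x)).real A ≤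
      P.real A + t / 2 * P.real A + ((∫ x, r x ^ 2 ∂P) - 1) / (2 * t) := by
  have hsub : Integrable (fun x => r x ^ 2 - 2 * r x) P := hi2.sub (hi.const_mul 2)
  have hsq : Integrable (fun x => (r x - 1) ^ 2) P := by
    have : (fun x => (r x - 1) ^ 2) = fun x => r x ^ 2 - 2 * r x + 1 := by ext; ring
    rw [this]
    exact hsub.add (integrable_const 1)
  have hsq' : ∫ x, (r x - 1) ^ 2 ∂P = (∫ x, r x ^ 2 ∂P) - 1 := by
    have : (fun x => (r x - 1) ^ 2) = fun x => r x ^ 2 - 2 * r x + 1 := by ext; ring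
    rw [this, integral_add hsub (integrable_const 1),
      integral_sub hi2 (hi.const_mul 2), integral_const_mul, h1]
    simp
    ring
  have hreal : (P.withDensity fun x => ENNReal.ofReal (r x)).real A = ∫ x in A, r x ∂P := by
    rw [Measure.real, withDensity_apply _ hA,
      integral_eq_lintegral_of_nonneg_ae (Filter.Eventually.of_forall hr)
        hi.1.restrict]
  rw [hreal]
  calc ∫ x in A, r x ∂P ≤ ∫ x in A, ((1 + t / 2) + (r x - 1) ^ 2 / (2 * t)) ∂P := by
        refine integral_mono hi.integrableOn
          ((integrable_const _).add (hsq.div_const _).integrableOn) fun x => ?_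
        have : 0 ≤ (r x - 1 - t) ^ 2 / (2 * t) := by positivity
        have h2 : (r x - 1 - t) ^ 2 / (2 * t) =
          (r x - 1) ^ 2 / (2 * t) - (r x - 1) + t / 2 := by field_simp; ring
        simp only
        linarith
    _ = (1 + t / 2) * P.real A + ∫ x in A, (r x - 1) ^ 2 / (2 * t) ∂P := by
        rw [integral_add (integrable_const _) (hsq.div_const _).integrableOn]
        simp [mul_comm]
    _ ≤ (1 + t / 2) * P.real A + ∫ x, (r x - 1) ^ 2 / (2 * t) ∂P := by
        have h2t : 0 ≤ 2 * t := by positivity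
        refine add_le_add_right ?_ _
        exact setIntegral_le_integral (hsq.div_const (2 * t))
          (Filter.Eventually.of_forall fun x => div_nonneg (sq_nonneg _) h2t)
    _ = _ := by rw [integral_div, hsq']; ring

/-- The numerical fact behind the constant `1/16`: with `n * χ ≤ ln (1/ε) / 16` the second moment of
the `n`-fold likelihood ratio exceeds `1` by at most `1 / (8ε)`. -/
theorem mul_exp_log_sub_one_le {ε : ℝ} (h0 : 0 < ε) (h1 : ε < 1) :
    ε * (Real.exp (1 / 16 * Real.log (1 / ε)) - 1) ≤ 1 / 8 := by
  set s := Real.log (1 / ε) with hs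
  have hs0 : 0 < s := Real.log_pos (by rw [lt_div_iff₀ h0]; linarith)
  have hε : ε = Real.exp (-s) := by
    rw [hs, one_div, Real.log_inv, neg_neg, Real.exp_log h0]
  rw [hε]
  have e1 : Real.exp (-s) * (Real.exp (1 / 16 * s) - 1) =
      Real.exp (-(15 / 16 * s)) * (1 - Real.exp (-(1 / 16 * s))) := by
    rw [mul_sub, mul_sub, ← Real.exp_add, ← Real.exp_add]
    ring_nf
  have e2 : 1 - Real.exp (-(1 / 16 * s)) ≤ 1 / 16 * s := by
    have := Real.add_one_le_exp (-(1 / 16 * s)); linarith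
  have e3 : 1 + 15 / 16 * s ≤ Real.exp (15 / 16 * s) := by
    have := Real.add_one_le_exp (15 / 16 * s); linarith
  rw [e1]
  calc _ ≤ Real.exp (-(15 / 16 * s)) * (1 / 16 * s) := by gcongr
    _ = (1 / 16 * s) / Real.exp (15 / 16 * s) := by rw [Real.exp_neg]; ring
    _ ≤ 1 / 8 := by
        rw [div_le_iff₀ (Real.exp_pos _)]
        linarith

/-- Three hypotheses whose `n`-fold products are close cannot be told apart with error probability
`ε`, for any `ε < 1/2`. The reference measure is `Q`; the other two have densities `r i` with
respect to `Q` and chi-square distance at most `χ` from it. With only two hypotheses the bound on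
`n * χ` would have to degenerate as `ε → 1/2`; here one of two disjoint events has `Q`-probability
at most `ε / 2`. -/
theorem not_three_disjoint_tests {Ω : Type*} [MeasurableSpace Ω] {Q : Measure Ω}
    [IsProbabilityMeasure Q] {r : Bool → Ω → ℝ} (hr : ∀ b x, 0 ≤ r b x)
    (hi : ∀ b, Integrable (r b) Q) (hi2 : ∀ b, Integrable (fun x => r b x ^ 2) Q)
    (h1 : ∀ b, ∫ x, r b x ∂Q = 1) {χ ε : ℝ} (hχ : ∀ b, ∫ x, r b x ^ 2 ∂Q ≤ 1 + χ)
    (n : ℕ) (h0 : 0 < ε) (hε : ε < 1 / 2) (hn : n * χ ≤ 1 / 16 * Real.log (1 / ε))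
    {A : Set (Fin n → Ω)} {B : Bool → Set (Fin n → Ω)} (hB : ∀ b, MeasurableSet (B b))
    (hAB : ∀ b, B b ⊆ Aᶜ) (hBB : Disjoint (B true) (B false))
    (hA' : (Measure.pi fun _ : Fin n => Q).real Aᶜ ≤ ε)
    (hB' : ∀ b, 1 - ε ≤ (Measure.pi fun _ : Fin n =>
      Q.withDensity fun x => ENNReal.ofReal (r b x)).real (B b)) : False := by
  set P := Measure.pi fun _ : Fin n => Q with hP
  have hsum : P.real (B true) + P.real (B false) ≤ ε := by
    rw [← measureReal_union hBB (hB false)]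
    exact (measureReal_mono (Set.union_subset (hAB _) (hAB _))).trans hA'
  obtain ⟨b, hb⟩ : ∃ b, P.real (B b) ≤ ε / 2 := by
    by_contra! h
    linarith [h true, h false]
  have hint : ∀ f : Ω → ℝ, Integrable f Q → Integrable (fun y : Fin n → Ω => ∏ i, f (y i)) P :=
    fun f hf => Integrable.fintype_prod_dep (μ := fun _ : Fin n => Q) fun _ => hf
  have key := withDensity_real_le (P := P) (r := fun y => ∏ i, r b (y i))
    (fun y => Finset.prod_nonneg fun i _ => hr b _) (hint _ (hi b))
    (by simpa only [Finset.prod_pow] using! hint _ (hi2 b))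
    (by rw [hP, integral_fintype_prod_eq_pow (fun x => r b x), h1, one_pow]) (hB b)
    (t := 1 / (2 * ε)) (by positivity)
  have hE : ∫ y, (∏ i, r b (y i)) ^ 2 ∂P ≤ Real.exp (1 / 16 * Real.log (1 / ε)) := by
    simp_rw [← Finset.prod_pow]
    rw [hP, integral_fintype_prod_eq_pow (fun x => r b x ^ 2), Fintype.card_fin]
    calc (∫ x, r b x ^ 2 ∂Q) ^ n ≤ (Real.exp χ) ^ n := by
          refine pow_le_pow_left₀ (integral_nonneg fun x => by positivity) ?_ n
          linarith [hχ b, Real.add_one_le_exp χ]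
      _ = Real.exp (n * χ) := (Real.exp_nat_mul χ n).symm
      _ ≤ _ := Real.exp_le_exp.2 hn
  rw [← pi_withDensity_ofReal (hr b) (hi b) n] at key
  have h2 := hB' b
  have h3 := mul_exp_log_sub_one_le h0 (by linarith : ε < 1)
  set E := Real.exp (1 / 16 * Real.log (1 / ε))
  have h4 : ((∫ y, (∏ i, r b (y i)) ^ 2 ∂P) - 1) / (2 * (1 / (2 * ε))) ≤ 1 / 8 := by
    have : 2 * (1 / (2 * ε)) = 1 / ε := by field_simp
    rw [this, div_div_eq_mul_div, div_one, mul_comm]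
    refine le_trans ?_ h3
    gcongr
  have h5 : 1 / (2 * ε) / 2 * P.real (B b) ≤ 1 / 8 := by
    calc _ ≤ 1 / (2 * ε) / 2 * (ε / 2) := by gcongr
      _ = 1 / 8 := by field_simp; norm_num
  linarith

/-! ### Plancherel and a weighted `L²` bound -/

theorem continuous_fourier_of_integrable {g : ℝ → ℂ} (hi : Integrable g) : Continuous (𝓕 g) :=
  VectorFourier.fourierIntegral_continuous Real.continuous_fourierChar
    (L := innerₗ ℝ) (by simpa using! continuous_inner) hi

theorem integrable_norm_sq_of_integrable_fourier {g : ℝ → ℂ} (hc : Continuous g)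
    (hi : Integrable g) (hF : Integrable (𝓕 g)) : Integrable fun x => ‖g x‖ ^ 2 := by
  have hinv : 𝓕⁻ (𝓕 g) = g := hc.fourierInv_fourier_eq hi hF
  have hb : ∀ x, ‖g x‖ ≤ ∫ ξ, ‖𝓕 g ξ‖ := by
    intro x
    conv_lhs => rw [← hinv, Real.fourierInv_eq]
    refine (norm_integral_le_integral_norm _).trans (le_of_eq ?_)
    simp
  have := hi.norm.bdd_mul (f := fun x => ‖g x‖) (c := ∫ ξ, ‖𝓕 g ξ‖)
    hc.norm.aestronglyMeasurable (Eventually.of_forall fun x => by simpa using hb x)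
  simpa [pow_two] using this

/-- Plancherel's identity for a continuous integrable function with integrable Fourier
transform. -/
theorem integral_norm_sq_eq_fourier {g : ℝ → ℂ} (hc : Continuous g)
    (hi : Integrable g) (hF : Integrable (𝓕 g)) :
    ∫ x, ‖g x‖ ^ 2 = ∫ ξ, ‖𝓕 g ξ‖ ^ 2 := by
  have hinv : 𝓕⁻ (𝓕 g) = g := hc.fourierInv_fourier_eq hi hF
  have key := VectorFourier.integral_sesq_fourierIntegral_eq_neg_flip (μ := volume) (ν := volume)
    (L := innerₗ ℝ) (f := g) (g := 𝓕 g) (innerSL ℂ) Real.continuous_fourierChar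
    (by simpa using! continuous_inner) hi hF
  have h1 : VectorFourier.fourierIntegral Real.fourierChar volume (innerₗ ℝ) g = 𝓕 g := rfl
  have h2 : VectorFourier.fourierIntegral Real.fourierChar volume (-(innerₗ ℝ).flip) (𝓕 g) = g := by
    conv_rhs => rw [← hinv]
    ext v
    simp [Real.fourierInv_eq, VectorFourier.fourierIntegral]
  rw [h1, h2] at key
  have h3 : ∀ z : ℂ, innerSL ℂ z z = ((‖z‖ ^ 2 : ℝ) : ℂ) := by
    intro z
    rw [innerSL_apply_apply, inner_self_eq_norm_sq_to_K]
    simp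
  simp only [h3] at key
  rw [integral_complex_ofReal, integral_complex_ofReal] at key
  exact_mod_cast key.symm

theorem lintegral_norm_sq_le {g : ℝ → ℂ} (hc : Continuous g) (hi : Integrable g)
    (hFc : Continuous (𝓕 g)) {D R : ℝ} (hD : ∀ ξ, ‖𝓕 g ξ‖ ≤ D) (hR0 : 0 ≤ R)
    (hR : ∀ ξ, R < |ξ| → 𝓕 g ξ = 0) :
    ∫⁻ x, ENNReal.ofReal (‖g x‖ ^ 2) ≤ ENNReal.ofReal (D ^ 2 * (2 * R)) := by
  have hsupp : HasCompactSupport (𝓕 g) := by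
    refine HasCompactSupport.intro (isCompact_Icc (a := -R) (b := R)) fun ξ hξ => hR ξ ?_
    rw [← not_le, abs_le]
    exact hξ
  have hF : Integrable (𝓕 g) := hFc.integrable_of_hasCompactSupport hsupp
  rw [← ofReal_integral_eq_lintegral_ofReal (integrable_norm_sq_of_integrable_fourier hc hi hF)
    (Eventually.of_forall fun x => by positivity), integral_norm_sq_eq_fourier hc hi hF]
  refine ENNReal.ofReal_le_ofReal ?_
  have h0 : ∫ ξ, ‖𝓕 g ξ‖ ^ 2 = ∫ ξ in Set.Icc (-R) R, ‖𝓕 g ξ‖ ^ 2 := by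
    refine (setIntegral_eq_integral_of_forall_compl_eq_zero fun ξ hξ => ?_).symm
    rw [hR ξ (by rw [← not_le, abs_le]; exact hξ)]
    simp
  have h1 := norm_setIntegral_le_of_norm_le_const (μ := volume) (s := Set.Icc (-R) R)
    (f := fun ξ => ‖𝓕 g ξ‖ ^ 2) (C := D ^ 2) (by simp) (fun ξ _ => by
      rw [Real.norm_of_nonneg (by positivity)]
      exact pow_le_pow_left₀ (norm_nonneg _) (hD ξ) 2)
  rw [h0]
  refine (le_abs_self _).trans (h1.trans (le_of_eq ?_))
  rw [Real.volume_real_Icc_of_le (by linarith)]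
  ring

/-- The weight `y²` becomes a derivative on the Fourier side, which is here a difference quotient
followed by Fatou's lemma: no more than a Lipschitz bound on `𝓕 g` is needed. -/
theorem lintegral_sq_mul_norm_sq_le {g : ℝ → ℂ} (hc : Continuous g) (hi : Integrable g)
    {D R : ℝ} (hLip : ∀ ξ η, ‖𝓕 g ξ - 𝓕 g η‖ ≤ D * |ξ - η|) (hR0 : 0 ≤ R)
    (hR : ∀ ξ, R < |ξ| → 𝓕 g ξ = 0) :
    ∫⁻ x, ENNReal.ofReal (x ^ 2 * ‖g x‖ ^ 2) ≤ ENNReal.ofReal (D ^ 2 * (2 * (R + 1))) := by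
  let e : ℝ → ℝ → ℂ := fun s x => Complex.exp (2 * Real.pi * s * x * Complex.I) - 1
  let s : ℕ → ℝ := fun n => 1 / ((n : ℝ) + 1)
  have hs0 : ∀ n, 0 < s n := fun n => by positivity
  have hs1 : ∀ n, s n ≤ 1 := fun n => by
    rw [div_le_one (by positivity)]; linarith [(n.cast_nonneg : (0 : ℝ) ≤ n)]
  have hslim : Tendsto s atTop (𝓝 0) := tendsto_one_div_add_atTop_nhds_zero_nat
  have hmod : ∀ t : ℝ,
      Integrable fun x : ℝ => Complex.exp (2 * Real.pi * t * x * Complex.I) * g x := by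
    intro t
    refine hi.bdd_mul (c := 1) (by fun_prop) (Eventually.of_forall fun x => ?_)
    have : (2 * Real.pi * t * x * Complex.I : ℂ) = ((2 * Real.pi * t * x : ℝ) : ℂ) * Complex.I := by
      push_cast; ring
    rw [this, Complex.norm_exp_ofReal_mul_I]
  have hgi : ∀ t, Integrable fun x => e t x * g x := by
    intro t
    have : (fun x => e t x * g x) =
        fun x : ℝ => Complex.exp (2 * Real.pi * t * x * Complex.I) * g x - g x := by
      ext x; simp only [e]; ring
    rw [this]
    exact (hmod t).sub hi
  have hgF : ∀ t ξ, 𝓕 (fun x => e t x * g x) ξ = 𝓕 g (ξ - t) - 𝓕 g ξ := by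
    intro t ξ
    have hu : ∀ ξ : ℝ,
        Integrable fun v : ℝ => Complex.exp (↑(-2 * Real.pi * v * ξ) * Complex.I) • g v := by
      intro ξ
      refine hi.bdd_mul (c := 1) (by fun_prop) (Eventually.of_forall fun x => ?_)
      rw [Complex.norm_exp_ofReal_mul_I]
    simp only [Real.fourier_real_eq_integral_exp_smul]
    rw [← integral_sub (hu _) (hu _)]
    congr 1 with v
    simp only [e, smul_eq_mul]
    rw [← mul_assoc, mul_sub, ← Complex.exp_add, mul_one, sub_mul]
    congr 3
    push_cast
    ring
  have hbound : ∀ n, ∫⁻ x, ENNReal.ofReal (‖e (s n) x * g x‖ ^ 2 / (s n) ^ 2) ≤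
      ENNReal.ofReal (D ^ 2 * (2 * (R + 1))) := by
    intro n
    have h := lintegral_norm_sq_le (g := fun x => e (s n) x * g x) (D := D * s n) (R := R + 1)
      (by fun_prop) (hgi _) (continuous_fourier_of_integrable (hgi _))
      (fun ξ => by
        rw [hgF]
        refine (hLip _ _).trans (le_of_eq ?_)
        rw [sub_sub_cancel_left, abs_neg, abs_of_pos (hs0 n)])
      (by linarith)
      (fun ξ hξ => by
        rw [hgF, hR, hR, sub_zero]
        · linarith
        · have := abs_sub_abs_le_abs_sub ξ (s n)
          rw [abs_of_pos (hs0 n)] at this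
          linarith [hs1 n])
    have hsn : 0 < s n ^ 2 := pow_pos (hs0 n) 2
    simp_rw [ENNReal.ofReal_div_of_pos hsn, div_eq_mul_inv]
    rw [lintegral_mul_const' _ _ (by simp [(hs0 n).ne']), ← div_eq_mul_inv]
    refine ENNReal.div_le_of_le_mul (h.trans (le_of_eq ?_))
    rw [← ENNReal.ofReal_mul' hsn.le]
    congr 1
    ring
  have hlim : ∀ x, Tendsto (fun n => ENNReal.ofReal (‖e (s n) x * g x‖ ^ 2 / (s n) ^ 2)) atTop
      (𝓝 (ENNReal.ofReal ((2 * Real.pi * x) ^ 2 * ‖g x‖ ^ 2))) := by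
    intro x
    refine ENNReal.tendsto_ofReal ?_
    have hd : HasDerivAt (fun t : ℝ => Complex.exp (2 * Real.pi * t * x * Complex.I))
        (2 * Real.pi * x * Complex.I) 0 := by
      have h1 : HasDerivAt (fun t : ℝ => (2 * Real.pi * (t : ℂ) * x * Complex.I))
          (2 * Real.pi * x * Complex.I) 0 := by
        have := ((Complex.ofRealCLM.hasDerivAt (x := (0 : ℝ))).const_mul
          (2 * Real.pi : ℂ)).mul_const ((x : ℂ) * Complex.I)
        simpa [mul_assoc] using this
      simpa using h1.cexp
    have h2 := (hasDerivAt_iff_tendsto_slope_zero.1 hd).comp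
      (tendsto_nhdsWithin_iff.2 ⟨hslim, Eventually.of_forall fun n => (hs0 n).ne'⟩)
    have h3 := ((h2.norm).pow 2).mul_const (‖g x‖ ^ 2)
    have h4 : ‖(2 * Real.pi * x * Complex.I : ℂ)‖ ^ 2 = (2 * Real.pi * x) ^ 2 := by
      have : (2 * Real.pi * x * Complex.I : ℂ) = ((2 * Real.pi * x : ℝ) : ℂ) * Complex.I := by
        push_cast; ring
      rw [this, norm_mul, Complex.norm_I, mul_one, Complex.norm_real, Real.norm_eq_abs, sq_abs]
    rw [h4] at h3
    refine h3.congr fun n => ?_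
    simp only [e, Function.comp_apply, zero_add, norm_mul, norm_smul, norm_inv]
    rw [Real.norm_of_nonneg (hs0 n).le]
    simp
    field_simp
  have hfatou := lintegral_liminf_le
    (f := fun n x => ENNReal.ofReal (‖e (s n) x * g x‖ ^ 2 / (s n) ^ 2)) (μ := volume)
    (u := atTop) (fun n => by
      have : Continuous fun x => ‖e (s n) x * g x‖ ^ 2 / (s n) ^ 2 := by fun_prop
      exact this.measurable.ennreal_ofReal)
  calc ∫⁻ x, ENNReal.ofReal (x ^ 2 * ‖g x‖ ^ 2)
      ≤ ∫⁻ x, liminf (fun n => ENNReal.ofReal (‖e (s n) x * g x‖ ^ 2 / (s n) ^ 2)) atTop := by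
        refine lintegral_mono fun x => ?_
        rw [(hlim x).liminf_eq]
        refine ENNReal.ofReal_le_ofReal ?_
        have : x ^ 2 ≤ (2 * Real.pi * x) ^ 2 := by
          rw [mul_pow]
          have : 1 ≤ (2 * Real.pi) ^ 2 := by nlinarith [Real.pi_gt_three]
          nlinarith [sq_nonneg x]
        gcongr
    _ ≤ _ := hfatou
    _ ≤ ENNReal.ofReal (D ^ 2 * (2 * (R + 1))) := by
        refine liminf_le_of_le (by isBoundedDefault) fun b hb => ?_
        obtain ⟨n, hn⟩ := hb.exists
        exact hn.trans (hbound n)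

theorem lintegral_one_add_sq_mul_norm_sq_le {g : ℝ → ℂ} (hc : Continuous g) (hi : Integrable g)
    {D R : ℝ} (hD : ∀ ξ, ‖𝓕 g ξ‖ ≤ D) (hLip : ∀ ξ η, ‖𝓕 g ξ - 𝓕 g η‖ ≤ D * |ξ - η|)
    (hR1 : 1 ≤ R) (hR : ∀ ξ, R < |ξ| → 𝓕 g ξ = 0) :
    ∫⁻ x, ENNReal.ofReal ((1 + x ^ 2) * ‖g x‖ ^ 2) ≤ ENNReal.ofReal (6 * D ^ 2 * R) := by
  have h1 := lintegral_norm_sq_le hc hi (continuous_fourier_of_integrable hi) hD (by linarith) hR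
  have h2 := lintegral_sq_mul_norm_sq_le hc hi hLip (by linarith) hR
  have hs : ∀ x, ENNReal.ofReal ((1 + x ^ 2) * ‖g x‖ ^ 2) =
      ENNReal.ofReal (‖g x‖ ^ 2) + ENNReal.ofReal (x ^ 2 * ‖g x‖ ^ 2) := by
    intro x
    rw [← ENNReal.ofReal_add (by positivity) (by positivity)]
    congr 1
    ring
  simp_rw [hs]
  rw [lintegral_add_left (by fun_prop)]
  refine (add_le_add h1 h2).trans ?_
  rw [← ENNReal.ofReal_add (by positivity) (by positivity)]
  refine ENNReal.ofReal_le_ofReal ?_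
  nlinarith [sq_nonneg D]

/-! ### Densities of the observations and the reduction to three hypotheses -/

theorem IsDensity.integrable {f : ℝ → ℝ} (hf : IsDensity f) : Integrable f := by
  refine ⟨hf.measurable.aestronglyMeasurable, ?_⟩
  rw [hasFiniteIntegral_iff_ofReal (Eventually.of_forall hf.nonneg), hf.lintegral_eq_one]
  exact ENNReal.one_lt_top

theorem IsDensity.integral_eq_one {f : ℝ → ℝ} (hf : IsDensity f) : ∫ x, f x = 1 := by
  rw [integral_eq_lintegral_of_nonneg_ae (Eventually.of_forall hf.nonneg)
    hf.measurable.aestronglyMeasurable, hf.lintegral_eq_one, ENNReal.toReal_one]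

theorem isDensity_of_integral_eq_one {f : ℝ → ℝ} (hm : Measurable f) (h0 : ∀ x, 0 ≤ f x)
    (hi : Integrable f) (h1 : ∫ x, f x = 1) : IsDensity f :=
  ⟨hm, h0, by rw [← ofReal_integral_eq_lintegral_ofReal hi (Eventually.of_forall h0), h1,
    ENNReal.ofReal_one]⟩

theorem IsDensity.isProbabilityMeasure {f : ℝ → ℝ} (hf : IsDensity f) :
    IsProbabilityMeasure (law f) :=
  ⟨by rw [law, withDensity_apply _ MeasurableSet.univ, setLIntegral_univ, hf.lintegral_eq_one]⟩

theorem IsDensity.cdf_law {f : ℝ → ℝ} (hf : IsDensity f) (t : ℝ) :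
    cdf (law f) t = ∫ x in Set.Iic t, f x := by
  have := hf.isProbabilityMeasure
  rw [cdf_eq_real, Measure.real, law, withDensity_apply _ measurableSet_Iic,
    integral_eq_lintegral_of_nonneg_ae (Eventually.of_forall hf.nonneg)
      hf.measurable.aestronglyMeasurable]

/-- The convolution of the function `f` with the error density `fζ`. For a density `f` it is the
density of an observation. -/
noncomputable def smear (fζ f : ℝ → ℝ) (y : ℝ) : ℝ :=
  ∫ z, fζ z * f (y - z)

theorem smear_eq_convolution (fζ f : ℝ → ℝ) :
    smear fζ f = convolution fζ f (ContinuousLinearMap.mul ℝ ℝ) volume := rfl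

theorem ofReal_smear (fζ f : ℝ → ℝ) :
    (fun y => (smear fζ f y : ℂ)) = convolution (fun x => (fζ x : ℂ)) (fun x => (f x : ℂ))
      (ContinuousLinearMap.mul ℂ ℂ) volume := by
  ext y
  simp only [smear, convolution, ContinuousLinearMap.mul_apply', ← Complex.ofReal_mul]
  exact integral_ofReal.symm

theorem fourier_smear {fζ f : ℝ → ℝ} (hζ : Integrable fζ) (hf : Integrable f) (ξ : ℝ) :
    𝓕 (fun y => (smear fζ f y : ℂ)) ξ = 𝓕 (fun x => (fζ x : ℂ)) ξ * 𝓕 (fun x => (f x : ℂ)) ξ := by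
  rw [ofReal_smear]
  exact Real.fourier_mul_convolution_eq hζ.ofReal hf.ofReal ξ

theorem integrable_smear {fζ f : ℝ → ℝ} (hζ : Integrable fζ) (hf : Integrable f) :
    Integrable (smear fζ f) :=
  hζ.integrable_convolution (ContinuousLinearMap.mul ℝ ℝ) hf

theorem continuous_smear {fζ f : ℝ → ℝ} (hζ : Integrable fζ) (hc : Continuous f) {C : ℝ}
    (hb : ∀ x, |f x| ≤ C) : Continuous (smear fζ f) := by
  rw [smear_eq_convolution]
  refine BddAbove.continuous_convolution_right_of_integrable _ ⟨C, ?_⟩ hζ hc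
  rintro _ ⟨x, rfl⟩
  exact hb x

theorem integrable_smear_integrand {fζ f : ℝ → ℝ} (hζ : Integrable fζ) (hc : Continuous f) {C : ℝ}
    (hb : ∀ x, |f x| ≤ C) (y : ℝ) : Integrable fun z => fζ z * f (y - z) :=
  hζ.mul_bdd (c := C) (by fun_prop) (Eventually.of_forall fun x => hb _)

theorem smear_add_mul {fζ f h : ℝ → ℝ} (hζ : Integrable fζ) (hcf : Continuous f)
    (hch : Continuous h) {C C' : ℝ} (hbf : ∀ x, |f x| ≤ C) (hbh : ∀ x, |h x| ≤ C') (s y : ℝ) :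
    smear fζ (fun x => f x + s * h x) y = smear fζ f y + s * smear fζ h y := by
  have h2 := (integrable_smear_integrand hζ hch hbh y).const_mul s
  simp only [smear]
  rw [← integral_const_mul, ← integral_add (integrable_smear_integrand hζ hcf hbf y) h2]
  congr 1 with z
  ring

theorem smear_comp_sub (fζ f : ℝ → ℝ) (t y : ℝ) :
    smear fζ (fun x => f (x - t)) y = smear fζ f (y - t) := by
  simp only [smear]
  congr 1 with z
  rw [sub_right_comm]

theorem smear_nonneg {fζ f : ℝ → ℝ} (hζ : ∀ x, 0 ≤ fζ x) (hf : ∀ x, 0 ≤ f x) (y : ℝ) :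
    0 ≤ smear fζ f y :=
  integral_nonneg fun z => mul_nonneg (hζ z) (hf _)

theorem law_conv_law {fζ f : ℝ → ℝ} (hζ : IsDensity fζ) (hf : IsDensity f) (hc : Continuous f)
    {C : ℝ} (hb : ∀ x, |f x| ≤ C) :
    (law f).conv (law fζ) = law (smear fζ f) := by
  have := hζ.isProbabilityMeasure
  have := hf.isProbabilityMeasure
  rw [Measure.conv_comm]
  simp only [law]
  rw [conv_withDensity_eq_lconvolution hζ.measurable.ennreal_ofReal hf.measurable.ennreal_ofReal]
  congr 1 with y
  rw [lconvolution_def, smear, ofReal_integral_eq_lintegral_ofReal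
    (integrable_smear_integrand hζ.integrable hc hb y)
    (Eventually.of_forall fun z => mul_nonneg (hζ.nonneg z) (hf.nonneg _))]
  refine lintegral_congr fun z => ?_
  rw [ENNReal.ofReal_mul (hζ.nonneg z), neg_add_eq_sub]

theorem isDensity_smear {fζ f : ℝ → ℝ} (hζ : IsDensity fζ) (hf : IsDensity f) (hc : Continuous f)
    {C : ℝ} (hb : ∀ x, |f x| ≤ C) : IsDensity (smear fζ f) where
  measurable := (continuous_smear hζ.integrable hc hb).measurable
  nonneg := smear_nonneg hζ.nonneg hf.nonneg
  lintegral_eq_one := by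
    have := hζ.isProbabilityMeasure
    have := hf.isProbabilityMeasure
    have h : (law (smear fζ f)) Set.univ = 1 := by
      rw [← law_conv_law hζ hf hc hb]
      exact measure_univ
    rwa [law, withDensity_apply _ MeasurableSet.univ, setLIntegral_univ] at h

/-- The lower bound for the `ε`-risk obtained from a density `f` and a perturbation `h` such that
the distributions with densities `f`, `f + h` and `f - h` all belong to the family. -/
theorem le_minimaxEpsRisk {fζ f h : ℝ → ℝ} (hζ : IsDensity fζ) (hf : IsDensity f)
    (hcf : Continuous f) (hch : Continuous h) {C : ℝ} (hbf : ∀ x, |f x| ≤ C)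
    (hhf : ∀ x, |h x| ≤ f x) (h0 : ∫ x, h x = 0) {𝓜 : Set (Measure ℝ)} (hmem : law f ∈ 𝓜)
    (hmem' : ∀ b : Bool, law (fun x => f x + (if b then 1 else -1) * h x) ∈ 𝓜)
    (hpos : ∀ y, 0 < smear fζ f y) {χ : ℝ}
    (hχ : ∫⁻ y, ENNReal.ofReal (smear fζ h y ^ 2 / smear fζ f y) ≤ ENNReal.ofReal χ) (hχ0 : 0 ≤ χ)
    {n : ℕ} {ε : ℝ} (hε0 : 0 < ε) (hε : ε < 1 / 2) (hn : n * χ ≤ 1 / 16 * Real.log (1 / ε))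
    (t₀ : ℝ) :
    ENNReal.ofReal ((∫ x in Set.Iic t₀, h x) / 2) ≤ minimaxEpsRisk fζ n t₀ 𝓜 ε := by
  set H := ∫ x in Set.Iic t₀, h x with hH
  refine le_iInf₂ fun T hT => le_iInf₂ fun δ hδ => ?_
  by_contra! hlt
  have hδH : (δ : ℝ) < H / 2 := by
    rw [← ENNReal.ofReal_coe_nnreal] at hlt
    exact (ENNReal.ofReal_lt_ofReal_iff_of_nonneg δ.2).1 hlt
  have hih : Integrable h := hf.integrable.mono' hch.aestronglyMeasurable
    (Eventually.of_forall hhf)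
  have hbh : ∀ x, |h x| ≤ C := fun x => (hhf x).trans ((le_abs_self _).trans (hbf x))
  let s : Bool → ℝ := fun b => if b then 1 else -1
  have hs : ∀ b, |s b| = 1 := by intro b; cases b <;> simp [s]
  have hs2 : ∀ b, s b ^ 2 = 1 := by intro b; cases b <;> simp [s]
  let fb : Bool → ℝ → ℝ := fun b x => f x + s b * h x
  have hfbc : ∀ b, Continuous (fb b) := fun b => by simp only [fb]; fun_prop
  have hfb : ∀ b, IsDensity (fb b) := fun b => by
    refine isDensity_of_integral_eq_one (hfbc b).measurable (fun x => ?_)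
      (hf.integrable.add (hih.const_mul _)) ?_
    · have h1 := neg_abs_le (s b * h x)
      rw [abs_mul, hs, one_mul] at h1
      simp only [fb]
      linarith [hhf x]
    · simp only [fb]
      rw [integral_add hf.integrable (hih.const_mul _), integral_const_mul, h0, hf.integral_eq_one]
      simp
  have hfbb : ∀ b x, |fb b x| ≤ 2 * C := fun b x => by
    refine (abs_add_le _ _).trans ?_
    rw [abs_mul, hs, one_mul]
    linarith [hbf x, hbh x]
  set p := smear fζ f
  set g := smear fζ h
  have hpd : IsDensity p := isDensity_smear hζ hf hcf hbf
  have hpb : ∀ b, smear fζ (fb b) = fun y => p y + s b * g y := fun b => by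
    ext y
    exact smear_add_mul hζ.integrable hcf hch hbf hbh _ _
  have hpbd : ∀ b, IsDensity (fun y => p y + s b * g y) := fun b => by
    rw [← hpb b]; exact isDensity_smear hζ (hfb b) (hfbc b) (hfbb b)
  have hgc : Continuous g := continuous_smear hζ.integrable hch hbh
  have hpc : Continuous p := continuous_smear hζ.integrable hcf hbf
  have hgi : Integrable g := integrable_smear hζ.integrable hih
  -- the likelihood ratios of one observation with respect to the unperturbed distribution
  let r : Bool → ℝ → ℝ := fun b y => (p y + s b * g y) / p y
  have hr0 : ∀ b y, 0 ≤ r b y := fun b y => div_nonneg ((hpbd b).nonneg y) (hpos y).le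
  have hrm : ∀ b, Measurable (r b) := fun b => by
    simp only [r]
    exact ((hpc.add (hgc.const_mul _)).measurable).div hpc.measurable
  have hpr : ∀ b y, p y * r b y = p y + s b * g y := fun b y => by
    simp only [r]
    rw [mul_div_cancel₀ _ (hpos y).ne']
  have hprobp : IsProbabilityMeasure (law p) := hpd.isProbabilityMeasure
  have hQb : ∀ b, (law p).withDensity (fun y => ENNReal.ofReal (r b y)) =
      law (fun y => p y + s b * g y) := fun b => by
    rw [law, ← withDensity_mul _ hpd.measurable.ennreal_ofReal (hrm b).ennreal_ofReal, law]
    congr 1 with y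
    rw [Pi.mul_apply, ← ENNReal.ofReal_mul (hpd.nonneg y), hpr]
  have hint : ∀ u : ℝ → ℝ, Integrable u (law p) ↔ Integrable fun y => p y * u y := fun u => by
    rw [law, integrable_withDensity_iff_integrable_smul' hpd.measurable.ennreal_ofReal
      (Eventually.of_forall fun _ => ENNReal.ofReal_lt_top)]
    simp only [ENNReal.toReal_ofReal (hpd.nonneg _), smul_eq_mul]
  have hint' : ∀ u : ℝ → ℝ, ∫ y, u y ∂(law p) = ∫ y, p y * u y := fun u => by
    rw [law, integral_withDensity_eq_integral_toReal_smul hpd.measurable.ennreal_ofReal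
      (Eventually.of_forall fun _ => ENNReal.ofReal_lt_top)]
    simp only [ENNReal.toReal_ofReal (hpd.nonneg _), smul_eq_mul]
  have hri : ∀ b, Integrable (r b) (law p) := fun b => by
    rw [hint]; simp only [hpr]; exact (hpbd b).integrable
  have hr1 : ∀ b, ∫ y, r b y ∂(law p) = 1 := fun b => by
    rw [hint']; simp only [hpr]; exact (hpbd b).integral_eq_one
  have hg0 : ∫ y, g y = 0 := by
    have h1 := (hpbd true).integral_eq_one
    rw [integral_add hpd.integrable (hgi.const_mul _), hpd.integral_eq_one] at h1
    simpa [s] using h1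
  have hqm : Continuous fun y => g y ^ 2 / p y := (hgc.pow 2).div hpc fun y => (hpos y).ne'
  have hq0 : ∀ y, 0 ≤ g y ^ 2 / p y := fun y => div_nonneg (sq_nonneg _) (hpos y).le
  have hqi : Integrable fun y => g y ^ 2 / p y := by
    refine ⟨hqm.aestronglyMeasurable, ?_⟩
    rw [hasFiniteIntegral_iff_ofReal (Eventually.of_forall hq0)]
    exact hχ.trans_lt ENNReal.ofReal_lt_top
  have hqχ : ∫ y, g y ^ 2 / p y ≤ χ := by
    rw [← ofReal_integral_eq_lintegral_ofReal hqi (Eventually.of_forall hq0)] at hχ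
    exact (ENNReal.ofReal_le_ofReal_iff hχ0).1 hχ
  -- `p r² = p + 2 s g + g² / p`, so the second moment of `r` is `1 + ∫ g² / p`
  have hpr2 : ∀ b, (fun y => p y * r b y ^ 2) =
      fun y => (p y + 2 * s b * g y) + g y ^ 2 / p y := fun b => by
    ext y
    have := (hpos y).ne'
    simp only [r]
    field_simp
    rw [add_sq, mul_pow, hs2]
    ring
  have hi1 : ∀ b, Integrable fun y => p y + 2 * s b * g y := fun b =>
    hpd.integrable.add (hgi.const_mul _)
  have hr2i : ∀ b, Integrable (fun y => r b y ^ 2) (law p) := fun b => by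
    rw [hint, hpr2]
    exact (hi1 b).add hqi
  have hr2 : ∀ b, ∫ y, r b y ^ 2 ∂(law p) ≤ 1 + χ := fun b => by
    rw [hint', hpr2, integral_add (hi1 b) hqi, integral_add hpd.integrable (hgi.const_mul _),
      integral_const_mul, hg0, hpd.integral_eq_one]
    linarith
  have hcdf : ∀ b, cdf (law (fb b)) t₀ = cdf (law f) t₀ + s b * H := fun b => by
    rw [(hfb b).cdf_law, hf.cdf_law, hH, ← integral_const_mul,
      ← integral_add hf.integrable.integrableOn (hih.const_mul _).integrableOn]
  have hobs : obsLaw fζ n (law f) = Measure.pi fun _ : Fin n => law p := by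
    rw [obsLaw, law_conv_law hζ hf hcf hbf]
  have hobsb : ∀ b, obsLaw fζ n (law (fb b)) = Measure.pi fun _ : Fin n =>
      (law p).withDensity (fun y => ENNReal.ofReal (r b y)) := fun b => by
    rw [obsLaw, law_conv_law hζ (hfb b) (hfbc b) (hfbb b), hpb, hQb]
  have hle : ∀ μ ∈ 𝓜, IsProbabilityMeasure (obsLaw fζ n μ) →
      (obsLaw fζ n μ).real {y | (δ : ℝ) < |T y - cdf μ t₀|} ≤ ε := by
    intro μ hμ _
    have h1 := (le_iSup₂ (f := fun μ (_ : μ ∈ 𝓜) =>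
      obsLaw fζ n μ {y | (δ : ℝ) < |T y - cdf μ t₀|}) μ hμ).trans hδ
    exact ENNReal.toReal_le_of_le_ofReal hε0.le h1
  have hBm : ∀ b, MeasurableSet {y | |T y - cdf (law (fb b)) t₀| ≤ δ} := fun b =>
    measurableSet_le (by fun_prop) measurable_const
  refine not_three_disjoint_tests (Q := law p) hr0 hri hr2i hr1 hr2 n hε0 hε hn
    (A := {y | |T y - cdf (law f) t₀| ≤ δ})
    (B := fun b => {y | |T y - cdf (law (fb b)) t₀| ≤ δ}) hBm ?_ ?_ ?_ ?_
  · intro b y hy hy'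
    simp only [Set.mem_ofPred_eq, hcdf] at hy hy'
    rw [abs_le] at hy hy'
    cases b <;> simp only [s] at hy <;> norm_num at hy <;> linarith [hy.1, hy.2, hy'.1, hy'.2]
  · rw [Set.disjoint_left]
    intro y hy hy'
    simp only [Set.mem_ofPred_eq, hcdf] at hy hy'
    rw [abs_le] at hy hy'
    simp only [s] at hy hy'
    norm_num at hy hy'
    linarith [hy.1, hy.2, hy'.1, hy'.2]
  · rw [← hobs]
    have : IsProbabilityMeasure (obsLaw fζ n (law f)) := by rw [hobs]; infer_instance
    convert hle _ hmem this using 2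
    ext y
    simp
  · intro b
    rw [← hobsb]
    have hpi : IsProbabilityMeasure ((law p).withDensity fun y => ENNReal.ofReal (r b y)) := by
      rw [hQb]; exact (hpbd b).isProbabilityMeasure
    have : IsProbabilityMeasure (obsLaw fζ n (law (fb b))) := by rw [hobsb]; infer_instance
    have h1 := hle _ (hmem' b) this
    have h2 := probReal_compl_eq_one_sub (μ := obsLaw fζ n (law (fb b))) (hBm b)
    have h3 : {y | |T y - cdf (law (fb b)) t₀| ≤ δ}ᶜ =
        {y : Fin n → ℝ | (δ : ℝ) < |T y - cdf (law (fb b)) t₀|} := by ext y; simp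
    rw [h3] at h2
    have h4 : (obsLaw fζ n (law (fb b))).real
      {y : Fin n → ℝ | (δ : ℝ) < |T y - cdf (law (fb b)) t₀|} ≤ ε := h1
    linarith

/-! ### The Cauchy density -/

theorem hat_eq_fourier (g : ℝ → ℝ) (ω : ℝ) :
    hat g ω = 𝓕 (fun x => (g x : ℂ)) (-ω / (2 * Real.pi)) := by
  rw [hat, Real.fourier_real_eq_integral_exp_smul]
  congr 1 with x
  rw [smul_eq_mul, mul_comm]
  congr 2
  have : (Real.pi : ℂ) ≠ 0 := by exact_mod_cast Real.pi_ne_zero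
  push_cast
  field_simp

theorem fourier_eq_hat (g : ℝ → ℝ) (ξ : ℝ) :
    𝓕 (fun x => (g x : ℂ)) ξ = hat g (-2 * Real.pi * ξ) := by
  rw [hat_eq_fourier]
  have := Real.pi_ne_zero
  field_simp

theorem integrable_exp_neg_abs : Integrable fun x : ℝ => Real.exp (-|x|) := by
  rw [← integrableOn_univ, ← Set.Iic_union_Ioi (a := (0 : ℝ))]
  refine IntegrableOn.union ?_ ?_
  · refine (integrableOn_congr_fun (fun x hx => ?_) measurableSet_Iic).1
      (integrableOn_exp_mul_Iic one_pos 0)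
    rw [abs_of_nonpos hx, neg_neg, one_mul]
  · refine (integrableOn_congr_fun (fun x hx => ?_) measurableSet_Ioi).1
      (integrableOn_exp_mul_Ioi neg_one_lt_zero 0)
    rw [abs_of_pos hx, neg_one_mul]

theorem fourier_exp_neg_abs (ξ : ℝ) :
    𝓕 (fun x : ℝ => (Real.exp (-|x|) : ℂ)) ξ = ((2 / (1 + (2 * Real.pi * ξ) ^ 2) : ℝ) : ℂ) := by
  rw [Real.fourier_real_eq_integral_exp_smul]
  set w : ℂ := 2 * Real.pi * ξ * Complex.I with hw
  have hre : w.re = 0 := by simp [hw]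
  have e1 : ∀ x ∈ Set.Ioi (0 : ℝ), Complex.exp (↑(-2 * Real.pi * x * ξ) * Complex.I) •
      (Real.exp (-|x|) : ℂ) = Complex.exp ((-1 - w) * x) := by
    intro x hx
    rw [abs_of_pos hx, smul_eq_mul, Complex.ofReal_exp, ← Complex.exp_add]
    congr 1
    simp only [hw]; push_cast; ring
  have e2 : ∀ x ∈ Set.Iic (0 : ℝ), Complex.exp (↑(-2 * Real.pi * x * ξ) * Complex.I) •
      (Real.exp (-|x|) : ℂ) = Complex.exp ((1 - w) * x) := by
    intro x hx
    rw [abs_of_nonpos hx, smul_eq_mul, Complex.ofReal_exp, ← Complex.exp_add]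
    congr 1
    simp only [hw]; push_cast; ring
  have i1 := (integrableOn_congr_fun e1 measurableSet_Ioi).2
    (integrableOn_exp_mul_complex_Ioi (a := -1 - w) (by simp [hre]) 0)
  have i2 := (integrableOn_congr_fun e2 measurableSet_Iic).2
    (integrableOn_exp_mul_complex_Iic (a := 1 - w) (by simp [hre]) 0)
  rw [← intervalIntegral.integral_Iic_add_Ioi i2 i1, setIntegral_congr_fun measurableSet_Iic e2,
    setIntegral_congr_fun measurableSet_Ioi e1, integral_exp_mul_complex_Iic (by simp [hre]),
    integral_exp_mul_complex_Ioi (by simp [hre])]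
  have h1 : (1 : ℂ) - w ≠ 0 := fun h => by simpa [hre] using congrArg Complex.re h
  have h2 : (-1 : ℂ) - w ≠ 0 := fun h => by simpa [hre] using congrArg Complex.re h
  have h3 : (1 : ℂ) + (2 * Real.pi * ξ) ^ 2 ≠ 0 := by
    have : (1 : ℝ) + (2 * Real.pi * ξ) ^ 2 ≠ 0 := by positivity
    exact_mod_cast this
  have hw2 : w ^ 2 = -(2 * Real.pi * ξ) ^ 2 := by
    rw [hw, mul_pow, Complex.I_sq]; ring
  push_cast
  simp only [mul_zero, Complex.exp_zero]
  rw [div_add_div _ _ h1 h2, div_eq_div_iff (mul_ne_zero h1 h2) h3]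
  linear_combination (-2 : ℂ) * hw2

/-- The Cauchy density, the centre of the three hypotheses. Its tails are as heavy as the
perturbations need, and its Fourier transform decays exponentially. -/
noncomputable def cauchy (x : ℝ) : ℝ := Real.pi⁻¹ * (1 + x ^ 2)⁻¹

theorem continuous_cauchy : Continuous cauchy := by
  unfold cauchy
  exact continuous_const.mul ((by fun_prop : Continuous fun x : ℝ => 1 + x ^ 2).inv₀
    fun x => by positivity)

theorem cauchy_pos (x : ℝ) : 0 < cauchy x := by
  have := Real.pi_pos
  unfold cauchy; positivity

theorem isDensity_cauchy : IsDensity cauchy := by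
  refine isDensity_of_integral_eq_one continuous_cauchy.measurable (fun x => (cauchy_pos x).le)
    (integrable_inv_one_add_sq.const_mul _) ?_
  unfold cauchy
  rw [integral_const_mul, integral_univ_inv_one_add_sq, inv_mul_cancel₀ Real.pi_ne_zero]

/-- Fourier inversion for `exp (-|x|)`, followed by the substitution `x = 2πξ`. -/
theorem hat_cauchy (ω : ℝ) : hat cauchy ω = (Real.exp (-|ω|) : ℂ) := by
  have hc : Continuous fun x : ℝ => (Real.exp (-|x|) : ℂ) := by fun_prop
  have hi : Integrable fun x : ℝ => (Real.exp (-|x|) : ℂ) := integrable_exp_neg_abs.ofReal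
  have hF : 𝓕 (fun x : ℝ => (Real.exp (-|x|) : ℂ)) =
      fun ξ => ((2 / (1 + (2 * Real.pi * ξ) ^ 2) : ℝ) : ℂ) := funext fourier_exp_neg_abs
  have hFi : Integrable (𝓕 (fun x : ℝ => (Real.exp (-|x|) : ℂ))) := by
    rw [hF]
    refine Integrable.ofReal ?_
    exact (integrable_inv_one_add_sq.comp_mul_left' (by positivity)).const_mul 2
  have hinv := congrFun (hc.fourierInv_fourier_eq hi hFi) ω
  rw [← hinv, hF, Real.fourierInv_eq']
  have hsub := Measure.integral_comp_mul_left (fun x : ℝ => (cauchy x : ℂ) *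
    Complex.exp (Complex.I * (ω : ℂ) * (x : ℂ))) (2 * Real.pi)
  have hpi := Real.pi_ne_zero
  rw [abs_of_pos (by positivity)] at hsub
  rw [hat, ← smul_inv_smul₀ (by positivity : (2 * Real.pi) ≠ 0) (∫ x : ℝ, (cauchy x : ℂ) *
    Complex.exp (Complex.I * (ω : ℂ) * (x : ℂ))), ← hsub,
    ← integral_smul]
  congr 1 with x
  rw [Complex.real_smul, smul_eq_mul, mul_comm _ (((2 / _ : ℝ) : ℂ)), ← mul_assoc,
    ← Complex.ofReal_mul]
  congr 2
  · unfold cauchy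
    field_simp
  · rw [Real.inner_apply]
    push_cast
    ring

/-- The Cauchy density uses at most `3/8` of the budget: the left-hand side is at most
`3/4 π⁻¹ 2^((α - 1)₊) Γ(2α + 1)`. -/
theorem lintegral_sobolev_cauchy_le {α L : ℝ} (hα : 1 / 2 < α)
    (hL : Real.pi⁻¹ * (2 : ℝ) ^ (1 + max (α - 1) 0) * Real.Gamma (2 * α + 1) ≤ L ^ 2) :
    ENNReal.ofReal (1 / (2 * Real.pi)) *
      ∫⁻ ω : ℝ, ENNReal.ofReal (Real.exp (-|ω|) ^ 2 * (1 + ω ^ 2) ^ α) ≤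
        ENNReal.ofReal (3 / 8 * L ^ 2) := by
  set κ : ℝ := 2 ^ max (α - 1) 0 with hκ
  have hκ0 : 0 < κ := by positivity
  have hG : 1 ≤ Real.Gamma (2 * α + 1) := by
    have h2 : Real.Gamma 2 = 1 := Real.Gamma_two
    rw [← h2]
    exact Real.Gamma_strictMonoOn_Ici.monotoneOn Set.self_mem_Ici (by simp; linarith)
      (by linarith)
  -- `(1 + u)^α ≤ 2^((α - 1)₊) (1 + u^α)` for `u ≥ 0`
  have hpow : ∀ ω : ℝ, (1 + ω ^ 2) ^ α ≤ κ * (1 + |ω| ^ (2 * α)) := by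
    intro ω
    have hω : |ω| ^ (2 * α) = (ω ^ 2) ^ α := by
      rw [Real.rpow_mul (abs_nonneg ω), Real.rpow_two, sq_abs]
    rw [hω]
    rcases le_total α 1 with h | h
    · rw [hκ, max_eq_right (by linarith), Real.rpow_zero, one_mul]
      simpa using Real.rpow_add_le_add_rpow zero_le_one (sq_nonneg ω) (by linarith) h
    · rw [hκ, max_eq_left (by linarith)]
      have := NNReal.rpow_add_le_mul_rpow_add_rpow 1 ⟨ω ^ 2, sq_nonneg ω⟩ h
      rw [NNReal.one_rpow] at this
      exact_mod_cast this
  set F : ℝ → ℝ := fun x => κ * (Real.exp (-2 * x) + x ^ (2 * α) * Real.exp (-2 * x)) with hFdef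
  have i1 : IntegrableOn (fun x : ℝ => Real.exp (-2 * x)) (Set.Ioi 0) :=
    integrableOn_exp_mul_Ioi (by norm_num) 0
  have i2 : IntegrableOn (fun x : ℝ => x ^ (2 * α) * Real.exp (-2 * x)) (Set.Ioi 0) := by
    have := integrableOn_rpow_mul_exp_neg_mul_rpow (p := 1) (s := 2 * α) (b := 2) (by linarith)
      one_pos two_pos
    simpa using this
  have hFi : IntegrableOn F (Set.Ioi 0) := (i1.add i2).const_mul κ
  have hFabs : Integrable fun ω => F |ω| := by
    rw [← integrableOn_univ, ← Set.Iic_union_Ioi (a := (0 : ℝ))]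
    have h1 : IntegrableOn (fun ω => F |ω|) (Set.Ioi 0) :=
      (integrableOn_congr_fun (fun x hx => by simp only [abs_of_pos (Set.mem_Ioi.1 hx)])
        measurableSet_Ioi).2 hFi
    refine IntegrableOn.union ?_ h1
    rw [integrableOn_Iic_iff_integrableOn_Iio]
    simpa using (show IntegrableOn (fun ω => F |ω|) (Set.Ioi (-0)) by simpa using h1).comp_neg_Iio
  have hval : ∫ ω, F |ω| ≤ 3 / 2 * κ * Real.Gamma (2 * α + 1) := by
    rw [integral_comp_abs, hFdef, integral_const_mul, integral_add i1 i2,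
      integral_exp_mul_Ioi (by norm_num)]
    have h1 := Real.integral_rpow_mul_exp_neg_mul_Ioi (a := 2 * α + 1) (r := 2) (by linarith)
      two_pos
    have h2 : ∫ x in Set.Ioi (0 : ℝ), x ^ (2 * α) * Real.exp (-2 * x) =
        (1 / 2) ^ (2 * α + 1) * Real.Gamma (2 * α + 1) := by
      rw [← h1]
      congr 1 with x
      ring_nf
    have h3 : (1 / 2 : ℝ) ^ (2 * α + 1) ≤ 1 / 4 := by
      calc (1 / 2 : ℝ) ^ (2 * α + 1) ≤ (1 / 2 : ℝ) ^ (2 : ℝ) :=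
            Real.rpow_le_rpow_of_exponent_ge (by norm_num) (by norm_num) (by linarith)
        _ = 1 / 4 := by norm_num
    rw [h2]
    have h4 : (1 / 2 : ℝ) ^ (2 * α + 1) * Real.Gamma (2 * α + 1) ≤
        1 / 4 * Real.Gamma (2 * α + 1) := by gcongr
    simp only [mul_zero, Real.exp_zero]
    have h5 : -1 / (-2 : ℝ) + (1 / 2 : ℝ) ^ (2 * α + 1) * Real.Gamma (2 * α + 1) ≤
        3 / 4 * Real.Gamma (2 * α + 1) := by linarith
    have h6 := mul_le_mul_of_nonneg_left h5 hκ0.le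
    linarith
  have hle : ∀ ω : ℝ, Real.exp (-|ω|) ^ 2 * (1 + ω ^ 2) ^ α ≤ F |ω| := by
    intro ω
    have h1 : Real.exp (-|ω|) ^ 2 = Real.exp (-2 * |ω|) := by
      rw [← Real.exp_nat_mul]; congr 1; push_cast; ring
    rw [h1]
    calc _ ≤ Real.exp (-2 * |ω|) * (κ * (1 + |ω| ^ (2 * α))) := by gcongr; exact hpow ω
      _ = F |ω| := by simp only [hFdef]; ring
  have hF0 : ∀ ω, 0 ≤ F |ω| := fun ω => le_trans (by positivity) (hle ω)
  calc _ ≤ ENNReal.ofReal (1 / (2 * Real.pi)) * ∫⁻ ω : ℝ, ENNReal.ofReal (F |ω|) := by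
        gcongr with ω
        exact hle ω
    _ = ENNReal.ofReal (1 / (2 * Real.pi) * ∫ ω, F |ω|) := by
        rw [← ofReal_integral_eq_lintegral_ofReal hFabs (Eventually.of_forall hF0),
          ENNReal.ofReal_mul (by positivity)]
    _ ≤ _ := by
        refine ENNReal.ofReal_le_ofReal ?_
        have h1 : (2 : ℝ) ^ (1 + max (α - 1) 0) = 2 * κ := by
          rw [Real.rpow_add two_pos, Real.rpow_one]
        rw [h1] at hL
        calc 1 / (2 * Real.pi) * ∫ ω, F |ω|
            ≤ 1 / (2 * Real.pi) * (3 / 2 * κ * Real.Gamma (2 * α + 1)) := by gcongr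
          _ = 3 / 8 * (Real.pi⁻¹ * (2 * κ) * Real.Gamma (2 * α + 1)) := by
              have := Real.pi_ne_zero
              field_simp; norm_num
          _ ≤ _ := by gcongr

/-- The observations have a density with tails at least as heavy as those of the Cauchy density:
half of the error mass lies in a bounded interval. -/
theorem exists_le_smear_cauchy {fζ : ℝ → ℝ} (hζ : IsDensity fζ) :
    ∃ c > 0, ∀ y, c / (1 + y ^ 2) ≤ smear fζ cauchy y := by
  have hb : ∀ x, |cauchy x| ≤ Real.pi⁻¹ := fun x => by
    rw [abs_of_pos (cauchy_pos x), cauchy]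
    refine mul_le_of_le_one_right (by positivity) (inv_le_one_of_one_le₀ (by nlinarith))
  obtain ⟨R, hR0, hR⟩ : ∃ R : ℝ, 0 ≤ R ∧ 1 / 2 ≤ ∫ z in Set.Ioc (-R) R, fζ z := by
    have h := intervalIntegral_tendsto_integral hζ.integrable tendsto_neg_atTop_atBot tendsto_id
    rw [hζ.integral_eq_one] at h
    obtain ⟨R, h1, h2⟩ := ((h.eventually (eventually_ge_nhds (by norm_num : (1 / 2 : ℝ) < 1))).and
      (eventually_ge_atTop 0)).exists
    refine ⟨R, h2, ?_⟩
    rwa [id, intervalIntegral.integral_of_le (by linarith)] at h1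
  refine ⟨Real.pi⁻¹ * (2 + 2 * R ^ 2)⁻¹ / 2, by have := Real.pi_pos; positivity, fun y => ?_⟩
  have hint := integrable_smear_integrand hζ.integrable continuous_cauchy hb y
  calc Real.pi⁻¹ * (2 + 2 * R ^ 2)⁻¹ / 2 / (1 + y ^ 2)
      = 1 / 2 * (Real.pi⁻¹ * (2 + 2 * R ^ 2)⁻¹ * (1 + y ^ 2)⁻¹) := by
        have : 1 + y ^ 2 ≠ 0 := by positivity
        field_simp
    _ ≤ (∫ z in Set.Ioc (-R) R, fζ z) * (Real.pi⁻¹ * (2 + 2 * R ^ 2)⁻¹ * (1 + y ^ 2)⁻¹) := by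
        gcongr
    _ = ∫ z in Set.Ioc (-R) R, fζ z * (Real.pi⁻¹ * (2 + 2 * R ^ 2)⁻¹ * (1 + y ^ 2)⁻¹) := by
        rw [integral_mul_const]
    _ ≤ ∫ z in Set.Ioc (-R) R, fζ z * cauchy (y - z) := by
        refine setIntegral_mono_on (hζ.integrable.mul_const _).integrableOn hint.integrableOn
          measurableSet_Ioc fun z hz => ?_
        refine mul_le_mul_of_nonneg_left ?_ (hζ.nonneg z)
        rw [cauchy, mul_assoc, ← mul_inv]
        have hz2 : z ^ 2 ≤ R ^ 2 := sq_le_sq' hz.1.le hz.2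
        have : 1 + (y - z) ^ 2 ≤ (2 + 2 * R ^ 2) * (1 + y ^ 2) := by
          nlinarith [sq_nonneg (y + z), mul_nonneg (sq_nonneg R) (sq_nonneg y)]
        gcongr
    _ ≤ smear fζ cauchy y :=
        setIntegral_le_integral hint (Eventually.of_forall fun z =>
          mul_nonneg (hζ.nonneg z) (cauchy_pos _).le)

/-! ### The profile of the perturbation -/

section

open scoped SchwartzMap ContDiff

/-- An even smooth bump supported in `1 ≤ |ξ| ≤ 3`. -/
theorem exists_even_bump : ∃ b : 𝓢(ℝ, ℂ), ∃ v : ℝ → ℝ, (∀ ξ, b ξ = v ξ) ∧ (∀ ξ, v (-ξ) = v ξ) ∧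
    (∀ ξ, |ξ| ≤ 1 ∨ 3 ≤ |ξ| → v ξ = 0) ∧ 0 < ∫ ξ, v ξ := by
  let φ : ContDiffBump (2 : ℝ) := ⟨1 / 2, 1, by norm_num, by norm_num⟩
  let v : ℝ → ℝ := fun ξ => φ ξ + φ (-ξ)
  have hv0 : ∀ ξ, |ξ| ≤ 1 ∨ 3 ≤ |ξ| → v ξ = 0 := by
    intro ξ h
    have h1 : φ ξ = 0 := φ.zero_of_le_dist (by
      show 1 ≤ dist ξ 2
      rw [Real.dist_eq, le_abs]
      rcases h with h | h
      · right; linarith [le_abs_self ξ]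
      · rcases le_abs.1 h with h | h
        · left; linarith
        · right; linarith)
    have h2 : φ (-ξ) = 0 := φ.zero_of_le_dist (by
      show 1 ≤ dist (-ξ) 2
      rw [Real.dist_eq, le_abs]
      rcases h with h | h
      · right; linarith [neg_abs_le ξ]
      · rcases le_abs.1 h with h | h
        · right; linarith
        · left; linarith)
    simp [v, h1, h2]
  have hvs : ContDiff ℝ ∞ v := by
    have h1 : ContDiff ℝ ∞ φ := φ.contDiff
    exact h1.add (h1.comp contDiff_neg)
  have hsupp : HasCompactSupport fun ξ => (v ξ : ℂ) :=
    HasCompactSupport.intro (isCompact_Icc (a := -3) (b := 3)) fun ξ hξ => by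
      rw [hv0 ξ (Or.inr ?_), Complex.ofReal_zero]
      rw [Set.mem_Icc, ← abs_le, not_le] at hξ
      exact hξ.le
  have hsm : ContDiff ℝ ∞ fun ξ => (v ξ : ℂ) := Complex.ofRealCLM.contDiff.comp hvs
  refine ⟨hsupp.toSchwartzMap hsm, v, fun ξ => rfl, fun ξ => ?_, hv0, ?_⟩
  · simp [v, add_comm]
  · have hi : Integrable φ := φ.continuous.integrable_of_hasCompactSupport φ.hasCompactSupport
    have hpos : 0 < ∫ ξ, φ ξ := φ.integral_pos
    simp only [v]
    rw [integral_add hi hi.comp_neg, integral_neg_eq_self (fun ξ => φ ξ)]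
    linarith

/-- The profile of the perturbation: a real Schwartz function whose Fourier transform vanishes
outside `1 ≤ |ξ| ≤ 3` and whose integral over the negative half-line is positive. It is the
derivative of the inverse Fourier transform of an even bump. -/
theorem exists_profile : ∃ k : ℝ → ℝ, Continuous k ∧ Integrable k ∧ ∫ x, k x = 0 ∧
    0 < ∫ x in Set.Iic 0, k x ∧ (∃ C > 0, ∀ x, |k x| * (1 + x ^ 2) ≤ C) ∧
    Differentiable ℝ (𝓕 fun x => (k x : ℂ)) ∧
    (∀ ξ, |ξ| ≤ 1 ∨ 3 ≤ |ξ| → 𝓕 (fun x => (k x : ℂ)) ξ = 0) ∧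
    ∃ M > 0, ∀ ξ, ‖𝓕 (fun x => (k x : ℂ)) ξ‖ ≤ M ∧ ‖deriv (𝓕 fun x => (k x : ℂ)) ξ‖ ≤ M := by
  obtain ⟨b, v, hbv, heven, hv0, hvpos⟩ := exists_even_bump
  let K : 𝓢(ℝ, ℂ) := 𝓕⁻ b
  let k : 𝓢(ℝ, ℂ) := SchwartzMap.derivCLM ℂ ℂ K
  have hKeq : ∀ x, K x = ∫ ξ, Complex.exp (↑(2 * Real.pi * (ξ * x)) * Complex.I) * v ξ := by
    intro x
    have h : K x = 𝓕⁻ (b : ℝ → ℂ) x := by rw [← SchwartzMap.fourierInv_coe]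
    rw [h, Real.fourierInv_eq']
    simp only [Real.inner_apply, smul_eq_mul, hbv]
  have hKconj : ∀ x, (starRingEnd ℂ) (K x) = K x := by
    intro x
    rw [hKeq, ← integral_conj, ← integral_neg_eq_self]
    congr 1 with ξ
    rw [map_mul, Complex.conj_ofReal, heven, ← Complex.exp_conj, map_mul, Complex.conj_ofReal,
      Complex.conj_I]
    congr 2
    push_cast
    ring
  have hK0 : K 0 = ((∫ ξ, v ξ : ℝ) : ℂ) := by
    rw [hKeq]
    simp [integral_complex_ofReal]
  have hKd : ∀ x, HasDerivAt K (k x) x := fun x => K.differentiableAt.hasDerivAt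
  have hKre : ∀ x, HasDerivAt (fun x => (K x).re) (k x).re x := fun x =>
    Complex.reCLM.hasFDerivAt.comp_hasDerivAt x (hKd x)
  have hKim : ∀ x, HasDerivAt (fun x => (K x).im) (k x).im x := fun x =>
    Complex.imCLM.hasFDerivAt.comp_hasDerivAt x (hKd x)
  have hKim0 : (fun x => (K x).im) = fun _ => 0 :=
    funext fun x => Complex.conj_eq_iff_im.1 (hKconj x)
  have hkim : ∀ x, (k x).im = 0 := fun x => by
    have h := hKim x
    rw [hKim0] at h
    exact h.unique (hasDerivAt_const x 0)
  have hkre : (fun x => ((k x).re : ℂ)) = k := funext fun x =>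
    Complex.ext (by simp) (by simp [hkim])
  have hkF : ∀ ξ, 𝓕 (k : ℝ → ℂ) ξ = (2 * Real.pi * Complex.I * ξ) * v ξ := by
    intro ξ
    have h1 : (k : ℝ → ℂ) = deriv K := rfl
    have h2 : 𝓕 (K : ℝ → ℂ) = b := by
      rw [← SchwartzMap.fourier_coe]
      simp [K]
    rw [h1, Real.fourier_deriv K.integrable K.differentiable (h1 ▸ k.integrable), h2]
    simp [hbv]
  have hFk : 𝓕 (k : ℝ → ℂ) = ((𝓕 k : 𝓢(ℝ, ℂ)) : ℝ → ℂ) := (SchwartzMap.fourier_coe k).symm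
  have hkc : Continuous fun x => (k x).re := Complex.continuous_re.comp k.continuous
  have hki : Integrable fun x => (k x).re := k.integrable.re
  refine ⟨fun x => (k x).re, hkc, hki, ?_, ?_, ?_, ?_, ?_, ?_⟩
  · have h1 := hkF 0
    rw [Real.fourier_real_eq_integral_exp_smul, ← hkre] at h1
    simp only [mul_zero, Complex.ofReal_zero, zero_mul, Complex.exp_zero, one_smul] at h1
    rw [integral_complex_ofReal] at h1
    exact_mod_cast h1
  · have hlim : Tendsto (fun x => (K x).re) atBot (𝓝 0) := by
      have h1 : Tendsto K atBot (𝓝 0) := K.tendsto_cocompact.mono_left atBot_le_cocompact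
      exact (Complex.continuous_re.tendsto 0).comp h1
    rw [integral_Iic_of_hasDerivAt_of_tendsto' (fun x _ => hKre x) hki.integrableOn hlim, hK0,
      Complex.ofReal_re, sub_zero]
    exact hvpos
  · obtain ⟨C0, h0, hC0⟩ := k.decay 0 0
    obtain ⟨C2, h2, hC2⟩ := k.decay 2 0
    refine ⟨C0 + C2, by positivity, fun x => ?_⟩
    have h3 := hC0 x
    have h4 := hC2 x
    simp only [pow_zero, one_mul, norm_iteratedFDeriv_zero, Real.norm_eq_abs, sq_abs] at h3 h4
    have h5 : |(k x).re| ≤ ‖k x‖ := Complex.abs_re_le_norm _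
    calc |(k x).re| * (1 + x ^ 2) ≤ ‖k x‖ * (1 + x ^ 2) := by gcongr
      _ ≤ C0 + C2 := by linarith
  · simp only [hkre]
    rw [hFk]
    exact SchwartzMap.differentiable _
  · intro ξ hξ
    simp only [hkre]
    rw [hkF, hv0 ξ hξ]
    simp
  · simp only [hkre]
    obtain ⟨C0, h0, hC0⟩ := (𝓕 k : 𝓢(ℝ, ℂ)).decay 0 0
    obtain ⟨C1, h1, hC1⟩ := (𝓕 k : 𝓢(ℝ, ℂ)).decay 0 1
    refine ⟨C0 + C1, by positivity, fun ξ => ?_⟩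
    have h3 := hC0 ξ
    have h4 := hC1 ξ
    simp only [pow_zero, one_mul, norm_iteratedFDeriv_zero, norm_iteratedFDeriv_one,
      ← norm_deriv_eq_norm_fderiv] at h3 h4
    rw [hFk]
    constructor <;> linarith

end

/-! ### The scaled perturbation -/

/-- The profile `k` compressed by the factor `N`, with amplitude `a` on the Fourier side. -/
noncomputable def wavelet (k : ℝ → ℝ) (a N x : ℝ) : ℝ := a * N * k (N * x)

theorem continuous_wavelet {k : ℝ → ℝ} (hk : Continuous k) (a N : ℝ) :
    Continuous (wavelet k a N) := by
  unfold wavelet; fun_prop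

theorem integrable_wavelet {k : ℝ → ℝ} (hk : Integrable k) (a : ℝ) {N : ℝ} (hN : N ≠ 0) :
    Integrable (wavelet k a N) :=
  (hk.comp_mul_left' hN).const_mul _

theorem integral_wavelet (k : ℝ → ℝ) (a : ℝ) {N : ℝ} (hN : 0 < N) :
    ∫ x, wavelet k a N x = a * ∫ x, k x := by
  simp only [wavelet]
  rw [integral_const_mul, Measure.integral_comp_mul_left, abs_of_pos (by positivity), smul_eq_mul]
  field_simp

theorem integral_Iic_wavelet (k : ℝ → ℝ) (a : ℝ) {N : ℝ} (hN : 0 < N) :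
    ∫ x in Set.Iic 0, wavelet k a N x = a * ∫ x in Set.Iic 0, k x := by
  have h := integral_wavelet ((Set.Iic 0).indicator k) a hN
  rw [integral_indicator measurableSet_Iic] at h
  rw [← h, ← integral_indicator measurableSet_Iic]
  congr 1 with x
  have : N * x ∈ Set.Iic (0 : ℝ) ↔ x ∈ Set.Iic (0 : ℝ) := by
    simp only [Set.mem_Iic]
    exact ⟨fun h => by by_contra! hx; linarith [mul_pos hN hx],
      fun h => mul_nonpos_of_nonneg_of_nonpos hN.le h⟩
  by_cases hx : x ∈ Set.Iic (0 : ℝ)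
  · simp [wavelet, Set.indicator_of_mem hx, Set.indicator_of_mem (this.2 hx)]
  · simp [wavelet, Set.indicator_of_notMem hx, Set.indicator_of_notMem (fun h => hx (this.1 h))]

theorem fourier_wavelet (k : ℝ → ℝ) (a : ℝ) {N : ℝ} (hN : 0 < N) (ξ : ℝ) :
    𝓕 (fun x => (wavelet k a N x : ℂ)) ξ = a * 𝓕 (fun x => (k x : ℂ)) (ξ / N) := by
  simp only [Real.fourier_real_eq_integral_exp_smul, wavelet]
  have h := Measure.integral_comp_mul_left
    (fun x : ℝ => Complex.exp (↑(-2 * Real.pi * x * (ξ / N)) * Complex.I) • (k x : ℂ)) N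
  rw [abs_of_pos (by positivity)] at h
  have h2 : ∫ x : ℝ, Complex.exp (↑(-2 * Real.pi * x * (ξ / N)) * Complex.I) • (k x : ℂ) =
      N • ∫ x : ℝ, Complex.exp (↑(-2 * Real.pi * (N * x) * (ξ / N)) * Complex.I) •
        (k (N * x) : ℂ) := by
    rw [h, smul_inv_smul₀ hN.ne']
  rw [h2, Complex.real_smul, ← mul_assoc, ← integral_const_mul]
  congr 1 with x
  have h3 : -2 * Real.pi * (N * x) * (ξ / N) = -2 * Real.pi * x * ξ := by field_simp
  rw [h3]
  simp only [smul_eq_mul]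
  push_cast
  ring

/-- The perturbed densities are nonnegative once the amplitude `a * N` is small. -/
theorem abs_wavelet_le {k : ℝ → ℝ} {C : ℝ} (hC0 : 0 < C) (hC : ∀ x, |k x| * (1 + x ^ 2) ≤ C)
    {a N : ℝ} (ha : 0 ≤ a) (hN : 1 ≤ N) (h : a * N * C * Real.pi ≤ 1) (x : ℝ) :
    |wavelet k a N x| ≤ cauchy x := by
  have hπ := Real.pi_pos
  have h1 : |k (N * x)| ≤ C * (1 + x ^ 2)⁻¹ := by
    rw [← div_eq_mul_inv, le_div_iff₀ (by positivity)]
    refine le_trans ?_ (hC (N * x))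
    have : x ^ 2 ≤ (N * x) ^ 2 := by
      rw [mul_pow]; exact le_mul_of_one_le_left (sq_nonneg x) (one_le_pow₀ hN)
    gcongr
  have haN : 0 ≤ a * N := mul_nonneg ha (by linarith)
  rw [wavelet, abs_mul, abs_of_nonneg haN]
  calc a * N * |k (N * x)| ≤ a * N * (C * (1 + x ^ 2)⁻¹) := by gcongr
    _ = (a * N * C * Real.pi) * (Real.pi⁻¹ * (1 + x ^ 2)⁻¹) := by field_simp
    _ ≤ 1 * (Real.pi⁻¹ * (1 + x ^ 2)⁻¹) := by gcongr
    _ = cauchy x := by rw [one_mul, cauchy]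

theorem norm_hat_comp_sub (f : ℝ → ℝ) (t ω : ℝ) : ‖hat (fun x => f (x - t)) ω‖ = ‖hat f ω‖ := by
  have h : hat (fun x => f (x - t)) ω = Complex.exp (↑(ω * t) * Complex.I) * hat f ω := by
    have h := integral_sub_right_eq_self (μ := volume)
      (fun y : ℝ => Complex.exp (↑(ω * t) * Complex.I) *
        ((f y : ℂ) * Complex.exp (Complex.I * (ω : ℂ) * (y : ℂ)))) t
    rw [hat, hat, ← integral_const_mul, ← h]
    congr 1 with x
    rw [mul_left_comm, ← Complex.exp_add]
    congr 2
    push_cast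
    ring
  rw [h, norm_mul, Complex.norm_exp_ofReal_mul_I, one_mul]

theorem hat_add_mul {f h : ℝ → ℝ} (hf : Integrable f) (hh : Integrable h) (s ω : ℝ) :
    hat (fun x => f x + s * h x) ω = hat f ω + s * hat h ω := by
  have hint : ∀ g : ℝ → ℝ, Integrable g →
      Integrable fun x : ℝ => (g x : ℂ) * Complex.exp (Complex.I * (ω : ℂ) * (x : ℂ)) := by
    intro g hg
    refine hg.ofReal.mul_bdd (c := 1) (by fun_prop) (Eventually.of_forall fun x => ?_)
    have : Complex.I * (ω : ℂ) * (x : ℂ) = ((ω * x : ℝ) : ℂ) * Complex.I := by push_cast; ring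
    rw [this, Complex.norm_exp_ofReal_mul_I]
  simp only [hat]
  rw [← integral_const_mul, ← integral_add (hint f hf) ((hint h hh).const_mul _)]
  congr 1 with x
  push_cast
  ring

/-- Moving a small perturbation of the Cauchy density to any point keeps it in the class. -/
theorem law_mem_sobolevClass {α L : ℝ} (hα : 1 / 2 < α)
    (hL : Real.pi⁻¹ * (2 : ℝ) ^ (1 + max (α - 1) 0) * Real.Gamma (2 * α + 1) ≤ L ^ 2)
    {h : ℝ → ℝ} (hc : Continuous h) (hi : Integrable h) (h0 : ∫ x, h x = 0)
    (hle : ∀ x, |h x| ≤ cauchy x)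
    (hh : ENNReal.ofReal (1 / (2 * Real.pi)) *
      ∫⁻ ω : ℝ, ENNReal.ofReal (‖hat h ω‖ ^ 2 * (1 + ω ^ 2) ^ α) ≤ ENNReal.ofReal (1 / 8 * L ^ 2))
    {s : ℝ} (hs : |s| ≤ 1) (t : ℝ) :
    law (fun x => cauchy (x - t) + s * h (x - t)) ∈ sobolevClass α L := by
  have hci := isDensity_cauchy.integrable
  have hd : Integrable fun x => cauchy x + s * h x := hci.add (hi.const_mul _)
  refine ⟨_, isDensity_of_integral_eq_one ?_ (fun x => ?_) (hd.comp_sub_right t) ?_, rfl, ?_⟩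
  · have := continuous_cauchy
    exact (by fun_prop : Continuous fun x => cauchy (x - t) + s * h (x - t)).measurable
  · have h1 := neg_abs_le (s * h (x - t))
    rw [abs_mul] at h1
    have h2 : |s| * |h (x - t)| ≤ 1 * |h (x - t)| := by gcongr
    linarith [hle (x - t)]
  · rw [integral_sub_right_eq_self (fun x => cauchy x + s * h x) t,
      integral_add hci (hi.const_mul _), integral_const_mul, h0,
      isDensity_cauchy.integral_eq_one]
    simp
  · have hpt : ∀ ω, ‖hat (fun x => cauchy (x - t) + s * h (x - t)) ω‖ ^ 2 * (1 + ω ^ 2) ^ α ≤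
        2 * (Real.exp (-|ω|) ^ 2 * (1 + ω ^ 2) ^ α) +
          2 * (‖hat h ω‖ ^ 2 * (1 + ω ^ 2) ^ α) := by
      intro ω
      rw [norm_hat_comp_sub (fun x => cauchy x + s * h x), hat_add_mul hci hi, hat_cauchy]
      have h1 : ‖(Real.exp (-|ω|) : ℂ) + s * hat h ω‖ ≤ Real.exp (-|ω|) + ‖hat h ω‖ := by
        refine (norm_add_le _ _).trans ?_
        rw [norm_mul, Complex.norm_real, Complex.norm_real, Real.norm_eq_abs, Real.norm_eq_abs,
          abs_of_pos (Real.exp_pos _)]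
        have : |s| * ‖hat h ω‖ ≤ 1 * ‖hat h ω‖ := by gcongr
        linarith
      have h2 : ‖(Real.exp (-|ω|) : ℂ) + s * hat h ω‖ ^ 2 ≤
          2 * Real.exp (-|ω|) ^ 2 + 2 * ‖hat h ω‖ ^ 2 := by
        refine (pow_le_pow_left₀ (norm_nonneg _) h1 2).trans ?_
        nlinarith [sq_nonneg (Real.exp (-|ω|) - ‖hat h ω‖)]
      calc _ ≤ (2 * Real.exp (-|ω|) ^ 2 + 2 * ‖hat h ω‖ ^ 2) * (1 + ω ^ 2) ^ α := by gcongr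
        _ = _ := by ring
    have h38 := lintegral_sobolev_cauchy_le hα hL
    calc _ ≤ ENNReal.ofReal (1 / (2 * Real.pi)) * ∫⁻ ω : ℝ,
          (2 * ENNReal.ofReal (Real.exp (-|ω|) ^ 2 * (1 + ω ^ 2) ^ α) +
            2 * ENNReal.ofReal (‖hat h ω‖ ^ 2 * (1 + ω ^ 2) ^ α)) := by
          gcongr with ω
          refine (ENNReal.ofReal_le_ofReal (hpt ω)).trans (le_of_eq ?_)
          rw [ENNReal.ofReal_add (by positivity) (by positivity), ENNReal.ofReal_mul two_pos.le,
            ENNReal.ofReal_mul two_pos.le, ENNReal.ofReal_ofNat]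
      _ = 2 * (ENNReal.ofReal (1 / (2 * Real.pi)) *
            ∫⁻ ω : ℝ, ENNReal.ofReal (Real.exp (-|ω|) ^ 2 * (1 + ω ^ 2) ^ α)) +
          2 * (ENNReal.ofReal (1 / (2 * Real.pi)) *
            ∫⁻ ω : ℝ, ENNReal.ofReal (‖hat h ω‖ ^ 2 * (1 + ω ^ 2) ^ α)) := by
          have hcont : Continuous fun ω : ℝ => Real.exp (-|ω|) ^ 2 * (1 + ω ^ 2) ^ α :=
            (by fun_prop : Continuous fun ω : ℝ => Real.exp (-|ω|) ^ 2).mul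
              ((by fun_prop : Continuous fun ω : ℝ => 1 + ω ^ 2).rpow_const
                fun ω => Or.inl (by positivity))
          rw [lintegral_add_left (hcont.measurable.ennreal_ofReal.const_mul _),
            lintegral_const_mul' _ _ (by simp), lintegral_const_mul' _ _ (by simp)]
          ring
      _ ≤ 2 * ENNReal.ofReal (3 / 8 * L ^ 2) + 2 * ENNReal.ofReal (1 / 8 * L ^ 2) := by gcongr
      _ = ENNReal.ofReal (L ^ 2) := by
          rw [← mul_add, ← ENNReal.ofReal_add (by positivity) (by positivity),
            ← ENNReal.ofReal_ofNat 2, ← ENNReal.ofReal_mul two_pos.le]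
          congr 1
          ring

theorem lintegral_sobolev_wavelet_le {k : ℝ → ℝ} {M : ℝ}
    (hM : ∀ ξ, ‖𝓕 (fun x => (k x : ℂ)) ξ‖ ≤ M)
    (hsupp : ∀ ξ, 3 ≤ |ξ| → 𝓕 (fun x => (k x : ℂ)) ξ = 0) {α : ℝ} (hα : 0 ≤ α)
    {a N : ℝ} (ha : 0 ≤ a) (hN : 1 ≤ N) :
    ENNReal.ofReal (1 / (2 * Real.pi)) *
      ∫⁻ ω : ℝ, ENNReal.ofReal (‖hat (wavelet k a N) ω‖ ^ 2 * (1 + ω ^ 2) ^ α) ≤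
        ENNReal.ofReal (6 * (20 ^ α) ^ 2 * M ^ 2 * (a ^ 2 * N ^ (2 * α + 1))) := by
  have hN0 : 0 < N := by linarith
  have hπ := Real.pi_pos
  have hM0 : 0 ≤ M := (norm_nonneg _).trans (hM 0)
  set R := 6 * Real.pi * N with hR
  set V := (a * M) ^ 2 * ((20 ^ α) ^ 2 * N ^ (2 * α)) with hV
  have hpt : ∀ ω : ℝ, ENNReal.ofReal (‖hat (wavelet k a N) ω‖ ^ 2 * (1 + ω ^ 2) ^ α) ≤
      (Set.Icc (-R) R).indicator (fun _ => ENNReal.ofReal V) ω := by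
    intro ω
    have hhat : hat (wavelet k a N) ω =
        a * 𝓕 (fun x => (k x : ℂ)) (-ω / (2 * Real.pi) / N) := by
      rw [hat_eq_fourier, fourier_wavelet k a hN0]
    by_cases hω : ω ∈ Set.Icc (-R) R
    · rw [Set.indicator_of_mem hω]
      refine ENNReal.ofReal_le_ofReal ?_
      have h1 : ‖hat (wavelet k a N) ω‖ ≤ a * M := by
        rw [hhat, norm_mul, Complex.norm_real, Real.norm_of_nonneg ha]
        gcongr
        exact hM _
      have h2 : (1 + ω ^ 2) ^ α ≤ (20 ^ α) ^ 2 * N ^ (2 * α) := by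
        have h3 : ω ^ 2 ≤ R ^ 2 := sq_le_sq' hω.1 hω.2
        have h4 : 1 + ω ^ 2 ≤ (20 * N) ^ 2 := by
          have hπ4 : Real.pi < 3.15 := Real.pi_lt_d2
          have : R ≤ 18.9 * N := by rw [hR]; nlinarith
          have : R ^ 2 ≤ (18.9 * N) ^ 2 := pow_le_pow_left₀ (by positivity) this 2
          nlinarith
        calc (1 + ω ^ 2) ^ α ≤ ((20 * N) ^ 2) ^ α := by gcongr
          _ = (20 ^ α) ^ 2 * N ^ (2 * α) := by
            rw [← Real.rpow_natCast, ← Real.rpow_natCast, ← Real.rpow_mul (by positivity),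
              ← Real.rpow_mul (by norm_num), Real.mul_rpow (by norm_num) hN0.le]
            push_cast
            ring_nf
      rw [hV]
      gcongr
    · rw [Set.indicator_of_notMem hω, hhat, hsupp]
      · simp
      · rw [Set.mem_Icc, ← abs_le, not_le] at hω
        rw [abs_div, abs_div, abs_neg, abs_of_pos hN0, abs_of_pos (by positivity : 0 < 2 * Real.pi),
          le_div_iff₀ hN0, le_div_iff₀ (by positivity)]
        linarith
  calc _ ≤ ENNReal.ofReal (1 / (2 * Real.pi)) *
        ∫⁻ ω : ℝ, (Set.Icc (-R) R).indicator (fun _ => ENNReal.ofReal V) ω := by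
        gcongr with ω
        exact hpt ω
    _ = ENNReal.ofReal (1 / (2 * Real.pi) * (V * (2 * R))) := by
        rw [lintegral_indicator_const measurableSet_Icc, Real.volume_Icc,
          ← ENNReal.ofReal_mul (by positivity), ← ENNReal.ofReal_mul (by positivity)]
        congr 3
        ring
    _ = _ := by
        congr 1
        rw [hV, hR, Real.rpow_add hN0, Real.rpow_one]
        field_simp

/-- The tail condition in terms of Mathlib's normalization `ξ = -ω / (2π)` of the frequency. -/
theorem ErrorTails.fourier {fζ : ℝ → ℝ} {β : ℝ} (hE : ErrorTails fζ β) :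
    Differentiable ℝ (𝓕 fun x => (fζ x : ℂ)) ∧ ∃ C > 0, ∃ ξ₀ > 0, ∀ ξ, ξ₀ ≤ |ξ| →
      ‖𝓕 (fun x => (fζ x : ℂ)) ξ‖ ≤ C * |ξ| ^ (-β) ∧
      ‖deriv (𝓕 fun x => (fζ x : ℂ)) ξ‖ ≤ C * |ξ| ^ (-β) := by
  have hπ := Real.pi_gt_three
  have hβ : 0 < β := by linarith [hE.half_lt]
  have hfun : (𝓕 fun x => (fζ x : ℂ)) = fun ξ => hat fζ (-2 * Real.pi * ξ) :=
    funext fun ξ => fourier_eq_hat fζ ξ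
  have hder : ∀ ξ, HasDerivAt (fun ξ => hat fζ (-2 * Real.pi * ξ))
      ((-2 * Real.pi) • deriv (hat fζ) (-2 * Real.pi * ξ)) ξ := by
    intro ξ
    have h1 : HasDerivAt (fun ξ : ℝ => -2 * Real.pi * ξ) (-2 * Real.pi) ξ := by
      simpa using (hasDerivAt_id ξ).const_mul (-2 * Real.pi)
    exact (hE.differentiable _).hasDerivAt.scomp ξ h1
  obtain ⟨C, hC, ω₀, hω₀, hb⟩ := hE.bound
  rw [hfun]
  refine ⟨fun ξ => (hder ξ).differentiableAt, 2 * Real.pi * C, by positivity, ω₀, hω₀,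
    fun ξ hξ => ?_⟩
  rw [(hder ξ).deriv]
  have hξ0 : 0 < |ξ| := hω₀.trans_le hξ
  set ω := -2 * Real.pi * ξ with hω
  have hωabs : |ω| = 2 * Real.pi * |ξ| := by
    rw [hω, abs_mul, abs_mul, abs_neg, abs_two, abs_of_pos Real.pi_pos]
  have hωξ : |ξ| ≤ |ω| := by rw [hωabs]; nlinarith
  have hpow : |ξ| ^ β ≤ (1 + ω ^ 2) ^ (β / 2) := by
    calc |ξ| ^ β = (|ξ| ^ 2) ^ (β / 2) := by
          rw [← Real.rpow_natCast, ← Real.rpow_mul hξ0.le]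
          congr 1
          push_cast; ring
      _ ≤ (1 + ω ^ 2) ^ (β / 2) := by
          refine Real.rpow_le_rpow (by positivity) ?_ (by positivity)
          rw [← sq_abs ω]
          have := pow_le_pow_left₀ hξ0.le hωξ 2
          linarith
  have key : ∀ j ≤ 2, ‖iteratedDeriv j (hat fζ) ω‖ ≤ C * |ξ| ^ (-β) := by
    intro j hj
    rw [Real.rpow_neg hξ0.le, ← div_eq_mul_inv, le_div_iff₀ (by positivity), mul_comm]
    refine le_trans ?_ (hb ω (hξ.trans hωξ) j hj)
    gcongr
  have k0 := key 0 (by norm_num)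
  have k1 := key 1 (by norm_num)
  rw [iteratedDeriv_zero] at k0
  rw [iteratedDeriv_one] at k1
  have hX : 0 ≤ C * |ξ| ^ (-β) := by positivity
  constructor
  · refine k0.trans ?_
    nlinarith
  · rw [norm_smul, norm_mul, norm_neg, Real.norm_of_nonneg Real.pi_pos.le, Real.norm_ofNat]
    calc 2 * Real.pi * ‖deriv (hat fζ) ω‖ ≤ 2 * Real.pi * (C * |ξ| ^ (-β)) := by gcongr
      _ = _ := by ring

/-- The weighted `L²` size of the perturbation after convolution with the error density. -/
theorem lintegral_one_add_sq_mul_smear_wavelet_sq_le {k : ℝ → ℝ} (hk : Continuous k)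
    (hki : Integrable k) {M : ℝ}
    (hdiff : Differentiable ℝ (𝓕 fun x => (k x : ℂ)))
    (hM : ∀ ξ, ‖𝓕 (fun x => (k x : ℂ)) ξ‖ ≤ M ∧ ‖deriv (𝓕 fun x => (k x : ℂ)) ξ‖ ≤ M)
    (hsupp : ∀ ξ, |ξ| ≤ 1 ∨ 3 ≤ |ξ| → 𝓕 (fun x => (k x : ℂ)) ξ = 0)
    {fζ : ℝ → ℝ} (hζ : Integrable fζ) {β C ξ₀ : ℝ} (hβ : 0 ≤ β) (hC0 : 0 < C)
    (hζd : Differentiable ℝ (𝓕 fun x => (fζ x : ℂ)))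
    (hC : ∀ ξ, ξ₀ ≤ |ξ| → ‖𝓕 (fun x => (fζ x : ℂ)) ξ‖ ≤ C * |ξ| ^ (-β) ∧
      ‖deriv (𝓕 fun x => (fζ x : ℂ)) ξ‖ ≤ C * |ξ| ^ (-β))
    {a N : ℝ} (ha : 0 ≤ a) (hN : 1 ≤ N) (hNξ : ξ₀ ≤ N)
    {B : ℝ} (hB : ∀ x, |wavelet k a N x| ≤ B) :
    ∫⁻ y, ENNReal.ofReal ((1 + y ^ 2) * smear fζ (wavelet k a N) y ^ 2) ≤
      ENNReal.ofReal (72 * (C * M) ^ 2 * (a ^ 2 * N ^ (1 - 2 * β))) := by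
  have hN0 : 0 < N := by linarith
  have hM0 : 0 ≤ M := (norm_nonneg _).trans (hM 0).1
  set m := 𝓕 fun x => (k x : ℂ)
  set Φ := 𝓕 fun x => (fζ x : ℂ)
  set D := 2 * a * M * C * N ^ (-β) with hD
  have hD0 : 0 ≤ D := by positivity
  have hwi := integrable_wavelet hki a hN0.ne'
  set g : ℝ → ℂ := fun y => (smear fζ (wavelet k a N) y : ℂ) with hg
  have hG : 𝓕 g = fun ξ => Φ ξ * (a * m (ξ / N)) := funext fun ξ => by
    rw [hg, fourier_smear hζ hwi, fourier_wavelet k a hN0]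
  have hmd : ∀ ξ, HasDerivAt (fun ξ => (a : ℂ) * m (ξ / N))
      (a * ((1 / N) • deriv m (ξ / N))) ξ := by
    intro ξ
    have h1 : HasDerivAt (fun ξ : ℝ => ξ / N) (1 / N) ξ := (hasDerivAt_id ξ).div_const N
    exact ((hdiff _).hasDerivAt.scomp ξ h1).const_mul _
  have hGd : ∀ ξ, HasDerivAt (𝓕 g)
      (deriv Φ ξ * (a * m (ξ / N)) + Φ ξ * (a * ((1 / N) • deriv m (ξ / N)))) ξ := by
    intro ξ
    rw [hG]
    exact (hζd ξ).hasDerivAt.mul (hmd ξ)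
  have hdecay : ∀ ξ, N ≤ |ξ| → ‖Φ ξ‖ ≤ C * N ^ (-β) ∧ ‖deriv Φ ξ‖ ≤ C * N ^ (-β) := by
    intro ξ hξ
    have h1 : |ξ| ^ (-β) ≤ N ^ (-β) := Real.rpow_le_rpow_of_nonpos hN0 hξ (by linarith)
    have h2 := hC ξ (hNξ.trans hξ)
    exact ⟨h2.1.trans (by gcongr), h2.2.trans (by gcongr)⟩
  have hGsmall : ∀ ξ, |ξ| ≤ N → 𝓕 g ξ = 0 := by
    intro ξ hξ
    rw [hG]
    simp only
    rw [hsupp (ξ / N) (Or.inl (by rwa [abs_div, abs_of_pos hN0, div_le_one hN0]))]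
    simp
  have hGbig : ∀ ξ, 3 * N < |ξ| → 𝓕 g ξ = 0 := by
    intro ξ hξ
    rw [hG]
    simp only
    rw [hsupp (ξ / N) (Or.inr (by rw [abs_div, abs_of_pos hN0, le_div_iff₀ hN0]; exact hξ.le))]
    simp
  have ham : ∀ ξ, ‖(a : ℂ) * m ξ‖ ≤ a * M := fun ξ => by
    rw [norm_mul, Complex.norm_real, Real.norm_of_nonneg ha]
    exact mul_le_mul_of_nonneg_left (hM ξ).1 ha
  have hamd : ∀ ξ, ‖(a : ℂ) * ((1 / N) • deriv m ξ)‖ ≤ a * M := fun ξ => by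
    rw [norm_mul, Complex.norm_real, Real.norm_of_nonneg ha, norm_smul,
      Real.norm_of_nonneg (by positivity)]
    have h1 : 1 / N * ‖deriv m ξ‖ ≤ 1 * M := by
      refine mul_le_mul ?_ (hM ξ).2 (norm_nonneg _) zero_le_one
      rwa [div_le_one hN0]
    rw [one_mul] at h1
    exact mul_le_mul_of_nonneg_left h1 ha
  have hNβ : 0 ≤ C * N ^ (-β) := by positivity
  have hbound : ∀ ξ, ‖𝓕 g ξ‖ ≤ D := by
    intro ξ
    rcases le_total |ξ| N with h | h
    · rw [hGsmall ξ h, norm_zero]; exact hD0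
    · rw [hG]
      simp only
      rw [norm_mul]
      calc _ ≤ C * N ^ (-β) * (a * M) :=
            mul_le_mul (hdecay ξ h).1 (ham _) (norm_nonneg _) hNβ
        _ ≤ D := by
            have : 0 ≤ C * N ^ (-β) * (a * M) := by positivity
            rw [hD]; linarith
  have hderiv : ∀ ξ, ‖deriv (𝓕 g) ξ‖ ≤ D := by
    intro ξ
    rcases lt_or_ge |ξ| N with h | h
    · have h1 : 𝓕 g =ᶠ[𝓝 ξ] fun _ => 0 := by
        filter_upwards [(continuous_abs.tendsto ξ).eventually (eventually_lt_nhds h)] with η hη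
        exact hGsmall η hη.le
      rw [h1.deriv_eq, deriv_const, norm_zero]
      exact hD0
    · rw [(hGd ξ).deriv]
      refine (norm_add_le _ _).trans ?_
      rw [norm_mul, norm_mul (Φ ξ)]
      calc _ ≤ C * N ^ (-β) * (a * M) + C * N ^ (-β) * (a * M) :=
            add_le_add (mul_le_mul (hdecay ξ h).2 (ham _) (norm_nonneg _) hNβ)
              (mul_le_mul (hdecay ξ h).1 (hamd _) (norm_nonneg _) hNβ)
        _ = D := by rw [hD]; ring
  have hLip : ∀ ξ η, ‖𝓕 g ξ - 𝓕 g η‖ ≤ D * |ξ - η| := fun ξ η =>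
    convex_univ.norm_image_sub_le_of_norm_deriv_le
      (fun x _ => (hGd x).differentiableAt) (fun x _ => hderiv x)
      (Set.mem_univ η) (Set.mem_univ ξ)
  have hgc : Continuous g :=
    Complex.continuous_ofReal.comp (continuous_smear hζ (continuous_wavelet hk a N) hB)
  have hgi : Integrable g := (integrable_smear hζ hwi).ofReal
  have h := lintegral_one_add_sq_mul_norm_sq_le hgc hgi hbound hLip (by linarith : 1 ≤ 3 * N) hGbig
  simp only [hg, Complex.norm_real, Real.norm_eq_abs, sq_abs] at h
  refine h.trans (ENNReal.ofReal_le_ofReal (le_of_eq ?_))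
  have h1 : N ^ (1 - 2 * β) = N * (N ^ (-β)) ^ 2 := by
    rw [← Real.rpow_natCast, ← Real.rpow_mul hN0.le, sub_eq_add_neg, Real.rpow_add hN0,
      Real.rpow_one]
    congr 2
    push_cast; ring
  rw [h1, hD]
  ring

/-! ### The minimax lower bounds -/

/-- At the scale `N = (W L² z)^(1 / (2α + 2β))` an amplitude proportional to `L N^(-(α + 1/2))` is
the rate of the lower bound. -/
theorem mul_rate_eq {α β : ℝ} (hα : 1 / 2 < α) (hβ : 1 / 2 < β) {W L z : ℝ} (hW : 0 < W)
    (hL : 0 < L) (hz : 0 < z) :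
    W ^ (-((2 * α + 1) / (4 * α + 4 * β))) * L ^ ((2 * β - 1) / (2 * α + 2 * β)) * rate α β z =
      L * ((W * L ^ 2 * z) ^ (1 / (2 * α + 2 * β))) ^ (-(α + 1 / 2)) := by
  set θ : ℝ := (2 * α + 1) / (4 * α + 4 * β) with hθ
  have h4' : 4 * α + 4 * β ≠ 0 := by linarith
  have h5 : 1 / (2 * α + 2 * β) * -(α + 1 / 2) = -θ := by
    have : 2 * α + 2 * β ≠ 0 := by linarith
    rw [hθ, one_div, ← div_eq_inv_mul, ← neg_div, div_eq_div_iff this h4']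
    ring
  have h6 : L ^ (-(2 * θ)) = (L ^ 2) ^ (-θ) := by
    rw [← Real.rpow_natCast, ← Real.rpow_mul hL.le]
    congr 1; push_cast; ring
  have h7 : (2 * β - 1) / (2 * α + 2 * β) = 1 + -(2 * θ) := by
    have : 2 * α + 2 * β ≠ 0 := by linarith
    have h8 : 2 * θ = (2 * α + 1) / (2 * α + 2 * β) := by
      rw [hθ, ← mul_div_assoc, div_eq_div_iff h4' this]
      ring
    rw [h8, eq_comm, ← sub_eq_add_neg, eq_div_iff this, sub_mul, div_mul_cancel₀ _ this]
    ring
  rw [← Real.rpow_mul (by positivity), h5, Real.mul_rpow (by positivity) hz.le,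
    Real.mul_rpow hW.le (by positivity), h7, Real.rpow_add hL, Real.rpow_one, h6, rate, ← hθ]
  ring

theorem lintegral_sq_div_le {p w : ℝ → ℝ} {c₀ X : ℝ} (hc₀ : 0 < c₀)
    (hp : ∀ y, c₀ / (1 + y ^ 2) ≤ p y)
    (hw : ∫⁻ y, ENNReal.ofReal ((1 + y ^ 2) * w y ^ 2) ≤ ENNReal.ofReal X) :
    ∫⁻ y, ENNReal.ofReal (w y ^ 2 / p y) ≤ ENNReal.ofReal (1 / c₀ * X) := by
  have h1 : ∀ y, w y ^ 2 / p y ≤ 1 / c₀ * ((1 + y ^ 2) * w y ^ 2) := by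
    intro y
    have hpos : 0 < p y := lt_of_lt_of_le (by positivity) (hp y)
    rw [div_le_iff₀ hpos]
    have h2 := hp y
    rw [div_le_iff₀ (by positivity)] at h2
    calc w y ^ 2 = 1 / c₀ * c₀ * w y ^ 2 := by field_simp
      _ ≤ 1 / c₀ * (p y * (1 + y ^ 2)) * w y ^ 2 := by gcongr
      _ = _ := by ring
  calc _ ≤ ∫⁻ y, ENNReal.ofReal (1 / c₀) * ENNReal.ofReal ((1 + y ^ 2) * w y ^ 2) := by
        refine lintegral_mono fun y => ?_
        rw [← ENNReal.ofReal_mul (by positivity)]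
        exact ENNReal.ofReal_le_ofReal (h1 y)
    _ ≤ ENNReal.ofReal (1 / c₀) * ENNReal.ofReal X := by
        rw [lintegral_const_mul' _ _ ENNReal.ofReal_ne_top]
        gcongr
    _ = _ := (ENNReal.ofReal_mul (by positivity)).symm

/-- The `ε`-risk bound, `z` being the effective sample size `n / ln (1 / ε)`. The scale `N` solves
`n * χ = ln (1 / ε) / 16`, where `χ` is the chi-square distance of the perturbed observations, and
the amplitude `a` is, up to a constant, the largest one that the Sobolev constraint allows. -/
theorem exists_le_minimaxEpsRisk {α β : ℝ} (hα : 1 / 2 < α) {fζ : ℝ → ℝ} (hζ : IsDensity fζ)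
    (hE : ErrorTails fζ β) :
    ∃ c > 0, ∀ L : ℝ, 0 < L →
      Real.pi⁻¹ * (2 : ℝ) ^ (1 + max (α - 1) 0) * Real.Gamma (2 * α + 1) ≤ L ^ 2 →
      ∃ n₀ : ℝ, 1 ≤ n₀ ∧ ∀ t₀ ε : ℝ, 0 < ε → ε < 1 / 2 →
        ∀ n : ℕ, n₀ * Real.log (1 / ε) ≤ (n : ℝ) →
          ENNReal.ofReal (c * L ^ ((2 * β - 1) / (2 * α + 2 * β)) *
              rate α β ((n : ℝ) / Real.log (1 / ε))) ≤
            minimaxEpsRisk fζ n t₀ (sobolevClass α L) ε := by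
  have hβ := hE.half_lt
  have hπ := Real.pi_pos
  obtain ⟨k, hkc, hki, hk0, hkpos, ⟨C, hC0, hC⟩, hkd, hks, M, hM0, hM⟩ := exists_profile
  obtain ⟨hζd, C₁, hC₁, ξ₀, hξ₀, hζb⟩ := hE.fourier
  obtain ⟨c₀, hc₀, hsm⟩ := exists_le_smear_cauchy hζ
  set I := ∫ x in Set.Iic 0, k x with hI
  -- `6 · (20^α)² · M² · κ² = 6/49 ≤ 1/8`, the share of the Sobolev budget left for the wavelet
  set κ : ℝ := 1 / (7 * 20 ^ α * M) with hκ
  have hκ0 : 0 < κ := by positivity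
  -- the chi-square distance of one observation is at most `A a² N^(1 - 2β)`
  set A : ℝ := 72 * (C₁ * M) ^ 2 / c₀ with hA
  have hA0 : 0 < A := by positivity
  set W : ℝ := 16 * A * κ ^ 2 with hW
  have hW0 : 0 < W := by positivity
  set e : ℝ := 2 * α + 2 * β with he
  have he0 : 0 < e := by linarith
  set θ : ℝ := (2 * α + 1) / (4 * α + 4 * β)
  refine ⟨κ * I / 2 * W ^ (-θ), by positivity, fun L hL hLb => ?_⟩
  have hNlim : Tendsto (fun z : ℝ => (W * L ^ 2 * z) ^ (1 / e)) atTop atTop :=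
    (tendsto_rpow_atTop (by positivity)).comp (tendsto_id.const_mul_atTop (by positivity))
  have hsmall : Tendsto (fun N : ℝ => κ * L * C * Real.pi * N ^ (-(α - 1 / 2))) atTop (𝓝 0) := by
    simpa using (tendsto_rpow_neg_atTop (by linarith : 0 < α - 1 / 2)).const_mul
      (κ * L * C * Real.pi)
  have hev := hNlim.eventually ((eventually_ge_atTop 1).and ((eventually_ge_atTop ξ₀).and
    (hsmall.eventually (eventually_le_nhds one_pos))))
  obtain ⟨n₁, hn₁⟩ := eventually_atTop.1 hev
  refine ⟨max n₁ 1, le_max_right _ _, fun t₀ ε hε0 hε n hn => ?_⟩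
  have hlog : 0 < Real.log (1 / ε) := Real.log_pos (by rw [lt_div_iff₀ hε0]; linarith)
  set z := (n : ℝ) / Real.log (1 / ε) with hz
  have hzn : max n₁ 1 ≤ z := by rwa [hz, le_div_iff₀ hlog]
  have hz0 : 0 < z := lt_of_lt_of_le one_pos ((le_max_right _ _).trans hzn)
  obtain ⟨hN1, hNξ, hNs⟩ := hn₁ z ((le_max_left _ _).trans hzn)
  set N := (W * L ^ 2 * z) ^ (1 / e) with hN
  have hN0 : 0 < N := by linarith
  have hNe : N ^ e = W * L ^ 2 * z := by
    rw [hN, ← Real.rpow_mul (by positivity), one_div_mul_cancel he0.ne', Real.rpow_one]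
  set a := κ * L * N ^ (-(α + 1 / 2)) with ha
  have ha0 : 0 < a := by positivity
  have ha2 : a ^ 2 = κ ^ 2 * L ^ 2 * N ^ (-(2 * α + 1)) := by
    rw [ha, mul_pow, mul_pow, ← Real.rpow_natCast (N ^ _), ← Real.rpow_mul hN0.le]
    congr 2
    push_cast; ring
  set h := wavelet k a N with hh
  have hhc : Continuous h := continuous_wavelet hkc a N
  have hhi : Integrable h := integrable_wavelet hki a hN0.ne'
  have hh0 : ∫ x, h x = 0 := by rw [hh, integral_wavelet k a hN0, hk0, mul_zero]
  have hhle : ∀ x, |h x| ≤ cauchy x := by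
    refine abs_wavelet_le hC0 hC ha0.le hN1 (le_trans (le_of_eq ?_) hNs)
    have : N ^ (-(α - 1 / 2)) = N ^ (-(α + 1 / 2)) * N := by
      rw [← Real.rpow_add_one hN0.ne']; congr 1; ring
    rw [ha, this]; ring
  have hcb : ∀ x, |cauchy x| ≤ Real.pi⁻¹ := fun x => by
    rw [abs_of_pos (cauchy_pos x), cauchy]
    exact mul_le_of_le_one_right (by positivity)
      (inv_le_one_of_one_le₀ (by nlinarith [sq_nonneg x]))
  have hsob : ENNReal.ofReal (1 / (2 * Real.pi)) *
      ∫⁻ ω : ℝ, ENNReal.ofReal (‖hat h ω‖ ^ 2 * (1 + ω ^ 2) ^ α) ≤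
        ENNReal.ofReal (1 / 8 * L ^ 2) := by
    refine (lintegral_sobolev_wavelet_le (fun ξ => (hM ξ).1) (fun ξ hξ => hks ξ (Or.inr hξ))
      (by linarith) ha0.le hN1).trans (ENNReal.ofReal_le_ofReal ?_)
    have h1 : a ^ 2 * N ^ (2 * α + 1) = κ ^ 2 * L ^ 2 := by
      rw [ha2, mul_assoc, ← Real.rpow_add hN0, neg_add_cancel, Real.rpow_zero, mul_one]
    rw [h1, hκ]
    have h2 : 6 * ((20 : ℝ) ^ α) ^ 2 * M ^ 2 * ((1 / (7 * 20 ^ α * M)) ^ 2 * L ^ 2) =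
        6 / 49 * L ^ 2 := by
      field_simp
      norm_num
    rw [h2]
    nlinarith [sq_nonneg L]
  have hmem : ∀ s : ℝ, |s| ≤ 1 →
      law (fun x => cauchy (x - t₀) + s * h (x - t₀)) ∈ sobolevClass α L := fun s hs =>
    law_mem_sobolevClass hα hLb hhc hhi hh0 hhle hsob hs t₀
  have hsmpos : ∀ y, 0 < smear fζ cauchy y := fun y =>
    lt_of_lt_of_le (by positivity) (hsm y)
  have hχ : ∫⁻ y, ENNReal.ofReal (smear fζ h y ^ 2 / smear fζ cauchy y) ≤
      ENNReal.ofReal (1 / (16 * z)) := by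
    have h3 := lintegral_one_add_sq_mul_smear_wavelet_sq_le hkc hki hkd hM hks hζ.integrable
      (by linarith : 0 ≤ β) hC₁ hζd hζb ha0.le hN1 hNξ
      (fun x => (hhle x).trans ((le_abs_self _).trans (hcb x)))
    refine (lintegral_sq_div_le hc₀ hsm h3).trans (ENNReal.ofReal_le_ofReal (le_of_eq ?_))
    have h4 : N ^ (-(2 * α + 1)) * N ^ (1 - 2 * β) = (W * L ^ 2 * z)⁻¹ := by
      rw [← Real.rpow_add hN0, ← hNe, ← Real.rpow_neg hN0.le, he]
      congr 1; ring
    calc _ = A * (κ ^ 2 * L ^ 2) * (N ^ (-(2 * α + 1)) * N ^ (1 - 2 * β)) := by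
          rw [ha2, hA]; ring
      _ = 1 / (16 * z) := by
          rw [h4, hW]; field_simp
  have hcc := continuous_cauchy
  have key := le_minimaxEpsRisk (f := fun x => cauchy (x - t₀)) (h := fun x => h (x - t₀))
    (𝓜 := sobolevClass α L) (C := Real.pi⁻¹) (χ := 1 / (16 * z)) (n := n) hζ ?_ (by fun_prop)
    (by fun_prop) (fun x => hcb _) (fun x => hhle _) ?_ ?_ ?_ ?_ ?_ (by positivity) hε0 hε ?_ t₀
  · refine le_trans (ENNReal.ofReal_le_ofReal (le_of_eq ?_)) key
    have h1 : ∫ x in Set.Iic t₀, h (x - t₀) = a * I := by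
      rw [hI, ← integral_Iic_wavelet k a hN0, ← hh, ← integral_indicator measurableSet_Iic,
        ← integral_indicator measurableSet_Iic,
        ← integral_sub_right_eq_self ((Set.Iic (0 : ℝ)).indicator h) t₀]
      congr 1 with x
      simp only [Set.indicator, Set.mem_Iic, sub_nonpos]
    have h2 := mul_rate_eq hα hβ hW0 hL hz0
    rw [h1, ha, mul_assoc (κ * I / 2 * _), mul_assoc (κ * I / 2), ← mul_assoc (W ^ _), h2]
    ring
  · refine isDensity_of_integral_eq_one (by fun_prop : Continuous _).measurable
      (fun x => (cauchy_pos _).le) (isDensity_cauchy.integrable.comp_sub_right t₀) ?_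
    rw [integral_sub_right_eq_self cauchy t₀, isDensity_cauchy.integral_eq_one]
  · rw [integral_sub_right_eq_self h t₀, hh0]
  · simpa using hmem 0 (by simp)
  · intro b
    exact hmem _ (by cases b <;> simp)
  · intro y
    rw [smear_comp_sub]
    exact hsmpos _
  · simp only [smear_comp_sub]
    rw [lintegral_sub_right_eq_self
      (fun y => ENNReal.ofReal (smear fζ h y ^ 2 / smear fζ cauchy y)) t₀]
    exact hχ
  · have hn0 : (n : ℝ) ≠ 0 := by
      intro h0
      rw [hz, h0, zero_div] at hz0
      exact lt_irrefl _ hz0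
    rw [hz]
    apply le_of_eq
    field_simp

/-- Chebyshev's inequality for an estimator, uniformly over the family. -/
theorem epsRisk_le_two_mul_quadRisk (fζ : ℝ → ℝ) (n : ℕ) (t₀ : ℝ) (𝓜 : Set (Measure ℝ))
    {T : (Fin n → ℝ) → ℝ} (hT : Measurable T) :
    epsRisk fζ n t₀ 𝓜 (1 / 4) T ≤ 2 * quadRisk fζ n t₀ 𝓜 T := by
  by_contra! hlt
  obtain ⟨δ, h1, h2⟩ := ENNReal.lt_iff_exists_nnreal_btwn.1 hlt
  suffices hδ : (⨆ μ ∈ 𝓜, obsLaw fζ n μ {y | (δ : ℝ) < |T y - cdf μ t₀|}) ≤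
      ENNReal.ofReal (1 / 4) from absurd h2 (not_lt.2 (iInf₂_le δ hδ))
  refine iSup₂_le fun μ hμ => ?_
  have hδ0 : (δ : ℝ≥0∞) ≠ 0 := (bot_lt_iff_ne_bot.1 (bot_le.trans_lt h1))
  have hq : (∫⁻ y, ENNReal.ofReal (|T y - cdf μ t₀| ^ 2) ∂(obsLaw fζ n μ)) ^ (1 / 2 : ℝ) ≤
      quadRisk fζ n t₀ 𝓜 T := le_iSup₂ (f := fun μ (_ : μ ∈ 𝓜) =>
    (∫⁻ y, ENNReal.ofReal (|T y - cdf μ t₀| ^ 2) ∂(obsLaw fζ n μ)) ^ (1 / 2 : ℝ)) μ hμ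
  set J := ∫⁻ y, ENNReal.ofReal (|T y - cdf μ t₀| ^ 2) ∂(obsLaw fζ n μ)
  have hJδ : 4 * J ≤ (δ : ℝ≥0∞) ^ 2 := by
    have h3 : 2 * J ^ (1 / 2 : ℝ) ≤ δ := (by gcongr : 2 * J ^ (1 / 2 : ℝ) ≤ _).trans h1.le
    have h4 : (J ^ (1 / 2 : ℝ)) ^ 2 = J := by
      rw [← ENNReal.rpow_natCast, ← ENNReal.rpow_mul]; norm_num
    calc 4 * J = (2 * J ^ (1 / 2 : ℝ)) ^ 2 := by rw [mul_pow, h4]; norm_num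
      _ ≤ _ := by gcongr
  have hmarkov := mul_meas_ge_le_lintegral (μ := obsLaw fζ n μ)
    (f := fun y => ENNReal.ofReal (|T y - cdf μ t₀| ^ 2)) (by fun_prop) ((δ : ℝ≥0∞) ^ 2)
  have hsub : {y : Fin n → ℝ | (δ : ℝ) < |T y - cdf μ t₀|} ⊆
      {y | (δ : ℝ≥0∞) ^ 2 ≤ ENNReal.ofReal (|T y - cdf μ t₀| ^ 2)} := by
    intro y hy
    have hy' : (δ : ℝ) < |T y - cdf μ t₀| := hy
    show (δ : ℝ≥0∞) ^ 2 ≤ ENNReal.ofReal (|T y - cdf μ t₀| ^ 2)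
    rw [ENNReal.ofReal_pow (abs_nonneg _), ← ENNReal.ofReal_coe_nnreal]
    gcongr
  have h5 : (δ : ℝ≥0∞) ^ 2 * (4 * obsLaw fζ n μ {y | (δ : ℝ) < |T y - cdf μ t₀|}) ≤
      (δ : ℝ≥0∞) ^ 2 * 1 := by
    calc _ = 4 * ((δ : ℝ≥0∞) ^ 2 * obsLaw fζ n μ {y | (δ : ℝ) < |T y - cdf μ t₀|}) := by ring
      _ ≤ 4 * J := by
          gcongr
          refine le_trans ?_ hmarkov
          gcongr
      _ ≤ _ := by rw [mul_one]; exact hJδ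
  have h6 := (ENNReal.mul_le_mul_iff_right (by positivity) (by simp)).1 h5
  rw [ENNReal.ofReal_div_of_pos (by norm_num), ENNReal.ofReal_one, ENNReal.ofReal_ofNat,
    ENNReal.le_div_iff_mul_le (by simp) (by simp), mul_comm]
  exact h6

end Deconv

theorem theorem2p2 (α β : ℝ) (hα : 1 / 2 < α) (fζ : ℝ → ℝ) (hfζ : Deconv.IsDensity fζ)
    (hE : Deconv.ErrorTails fζ β) :
    ∃ c₁ > 0, ∃ c₂ > 0, ∀ L : ℝ, 0 < L →
      Real.pi⁻¹ * (2 : ℝ) ^ (1 + max (α - 1) 0) * Real.Gamma (2 * α + 1) ≤ L ^ 2 →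
      ∃ n₀ : ℝ, ∀ t₀ : ℝ,
        (∀ n : ℕ, n₀ ≤ (n : ℝ) →
          ENNReal.ofReal
              (c₁ * L ^ ((2 * β - 1) / (2 * α + 2 * β)) * Deconv.rate α β (n : ℝ)) ≤
            Deconv.minimaxQuadRisk fζ n t₀ (Deconv.sobolevClass α L)) ∧
        (∀ ε : ℝ, 0 < ε → ε < 1 / 2 → ∀ n : ℕ, n₀ * Real.log (1 / ε) ≤ (n : ℝ) →
          ENNReal.ofReal
              (c₂ * L ^ ((2 * β - 1) / (2 * α + 2 * β)) *
                Deconv.rate α β ((n : ℝ) / Real.log (1 / ε))) ≤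
            Deconv.minimaxEpsRisk fζ n t₀ (Deconv.sobolevClass α L) ε) := by
  obtain ⟨c, hc, h⟩ := Deconv.exists_le_minimaxEpsRisk hα hfζ hE
  have hβ := hE.half_lt
  refine ⟨c / 2, by positivity, c, hc, fun L hL hLb => ?_⟩
  obtain ⟨n₀, hn₀, hb⟩ := h L hL hLb
  have hlog : 1 ≤ Real.log (1 / (1 / 4)) := by
    have h4 : (1 / (1 / 4) : ℝ) = 2 ^ 2 := by norm_num
    rw [h4, Real.log_pow]
    have := Real.log_two_gt_d9
    push_cast; linarith
  refine ⟨n₀ * Real.log (1 / (1 / 4)), fun t₀ => ⟨fun n hn => le_iInf₂ fun T hT => ?_,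
    fun ε hε0 hε n hn => hb t₀ ε hε0 hε n ?_⟩⟩
  · have h1 := (hb t₀ (1 / 4) (by norm_num) (by norm_num) n hn).trans
      ((iInf₂_le T hT).trans
        (Deconv.epsRisk_le_two_mul_quadRisk fζ n t₀ (Deconv.sobolevClass α L) hT))
    have hn0 : (0 : ℝ) < n := lt_of_lt_of_le (by positivity) hn
    -- the rate decreases, so passing from `n / ln 4` to `n` only weakens the bound
    have hrate : Deconv.rate α β n ≤ Deconv.rate α β (n / Real.log (1 / (1 / 4))) := by
      refine Real.rpow_le_rpow_of_nonpos (by positivity) (div_le_self hn0.le hlog) ?_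
      rw [neg_nonpos]
      exact div_nonneg (by linarith) (by linarith)
    refine (ENNReal.mul_le_mul_iff_right two_ne_zero ENNReal.ofNat_ne_top).1 (le_trans ?_ h1)
    rw [← ENNReal.ofReal_ofNat 2, ← ENNReal.ofReal_mul two_pos.le]
    refine ENNReal.ofReal_le_ofReal ?_
    calc 2 * (c / 2 * L ^ ((2 * β - 1) / (2 * α + 2 * β)) * Deconv.rate α β n)
        = c * L ^ ((2 * β - 1) / (2 * α + 2 * β)) * Deconv.rate α β n := by ring
      _ ≤ _ := by gcongr
  · refine le_trans ?_ hn
    have : 0 < Real.log (1 / ε) := Real.log_pos (by rw [lt_div_iff₀ hε0]; linarith)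
    gcongr
    exact le_mul_of_one_le_right (by linarith) hlog
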